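/- **Setting.** Fix a single-sorted first-order language without equality, with variables $x_0,x_1,\dots$. A literal is an atom $P$ or a negated atom $\neg P$; a clause is a finite multiset of literals, read as the universal closure of their disjunction. A *one-way clause* is a clause $L, C_1,\dots,C_p$ ($p\ge 0$) with a distinguished (*selected*) literal $L$. Let $T$ be a (possibly infinite) set of one-way clauses such that, for every $n\ge 0$, infinitely many function symbols of arity $n$ of the language (constants, for $n=0$) do not occur in $T$. **Polarized resolution modulo.** Given a set $U$ of (ordinary) clauses, the derivable clauses are the least set of clauses that contains $U$, is closed under renaming of variables, and is closed under the following two rules, in which the premises share no variable. * From derivable clauses $P_1,\dots,P_n,C$ and $\neg Q_1,\dots,\neg Q_m,D$ with $n,m\ge 1$, and a most general unifier $\sigma$ of $P_1,\dots,P_n,Q_1,\dots,Q_m$, derive $\sigma(C,D)$. * From a variable-renamed copy $L,C_1,\dots,C_p$ of a one-way clause of $T$ with selected literal $L$, a derivable clause $L'_1,\dots,L'_m,D$ with $m\ge 1$ in which every $L'_i$ has the sign opposite to that of $L$, and a most general unifier $\sigma$ of the atoms of $L,L'_1,\dots,L'_m$, derive $\sigma(C_1,\dots,C_p,D)$. Thus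 two one-way clauses are never resolved with each other, and in a one-way clause only the selected literal is resolved upon. The method with $T$ is *(refutationally) complete* if, for every set $U$ of clauses such that $T\cup U$ has no model, the empty clause is derivable from $U$. **Rewrite system.** Propositions are built from atoms with $\bot,\neg,\vee,\forall$. The polarized rewrite system $\mathcal R$ associated with $T$ has, for each one-way clause $L,C_1,\dots,C_p$ of $T$, the negative rule $P\longrightarrow_-\forall x_1\cdots\forall x_n(C_1\vee\cdots\vee C_p)$ if $L=\neg P$, and the positive rule $P\longrightarrow_+\neg\forall x_1\cdots\forall x_n(C_1\vee\cdots\vee C_p)$ if $L=P$, where $x_1,\dots,x_n$ are the variables of $C_1,\dots,C_p$ that do not occur in $P$ (the empty disjunction is $\bot$). The relations $\longrightarrow_-$ and $\longrightarrow_+$ rewrite instances of left-hand sides of rules of that polarity, and are closed under $\vee$ and $\forall$ with the same polarity and under $\neg$ with the opposite polarity. $\longrightarrow_\pm^*$ are their reflexive-transitive closures. **Polarized sequent calculus modulo $\mathcal R$.** Sequents $\Gamma\vdash\Delta$ consist of finite multisets of propositions. The rules are: * axiom: $A\vdash B$ if $A\longrightarrow_-^*P$ and $B\longrightarrow_+^*P$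 for an atom $P$; * cut: from $\Gamma,B\vdash\Delta$ and $\Gamma\vdash C,\Delta$ infer $\Gamma\vdash\Delta$, if $A\longrightarrow_-^*B$ and $A\longrightarrow_+^*C$ for some $A$; * contraction: from $\Gamma,B,C\vdash\Delta$ infer $\Gamma,A\vdash\Delta$ if $A\longrightarrow_-^*B$ and $A\longrightarrow_-^*C$; from $\Gamma\vdash B,C,\Delta$ infer $\Gamma\vdash A,\Delta$ if $A\longrightarrow_+^*B$ and $A\longrightarrow_+^*C$; * weakening on the left and on the right; * $\bot$-left: $\Gamma,A\vdash\Delta$ if $A\longrightarrow_-^*\bot$; * $\neg$-left: from $\Gamma\vdash B,\Delta$ infer $\Gamma,A\vdash\Delta$ if $A\longrightarrow_-^*\neg B$; $\neg$-right: from $\Gamma,B\vdash\Delta$ infer $\Gamma\vdash A,\Delta$ if $A\longrightarrow_+^*\neg B$; * $\vee$-left: from $\Gamma,B\vdash\Delta$ and $\Gamma,C\vdash\Delta$ infer $\Gamma,A\vdash\Delta$ if $A\longrightarrow_-^*B\vee C$; $\vee$-right: from $\Gamma\vdash B,C,\Delta$ infer $\Gamma\vdash A,\Delta$ if $A\longrightarrow_+^*B\vee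 C$; * $\forall$-left: from $\Gamma,C\vdash\Delta$ infer $\Gamma,A\vdash\Delta$ if $A\longrightarrow_-^*\forall x\,B$ and $(t/x)B\longrightarrow_-^*C$ for a term $t$; $\forall$-right: from $\Gamma\vdash B,\Delta$ infer $\Gamma\vdash A,\Delta$ if $A\longrightarrow_+^*\forall x\,B$ and $x$ is not free in $\Gamma,\Delta$. The calculus *admits the cut rule* if every sequent that has a proof has a proof without the cut rule. **Theorem.** Polarized resolution modulo with the set $T$ of one-way clauses is complete if and only if the polarized sequent calculus modulo $\mathcal R$ admits the cut rule. -/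

import Mathlib

universe u v

namespace PolRes

/-! ### Atoms, literals and clauses. Variables are natural numbers; there is no equality symbol. -/

/-- An atomic proposition `R(t₁, …, tₙ)` over the first-order language `L`. -/
structure Atom (L : FirstOrder.Language.{u, v}) where
  arity : ℕ
  rel : L.Relations arity
  args : Fin arity → L.Term ℕ

/-- Substitutions of terms for variables. -/
abbrev Subst (L : FirstOrder.Language.{u, v}) := ℕ → L.Term ℕ

/-- The renaming of variables `ρ`, as a substitution. -/
def renameSubst {L : FirstOrder.Language.{u, v}} (ρ : ℕ → ℕ) : Subst L :=
  fun n => FirstOrder.Language.Term.var (ρ n)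

namespace Atom

variable {L : FirstOrder.Language.{u, v}}

def subst (P : Atom L) (σ : Subst L) : Atom L :=
  ⟨P.arity, P.rel, fun i => (P.args i).subst σ⟩

def vars (P : Atom L) : Finset ℕ :=
  Finset.univ.biUnion fun i => (P.args i).varFinset

def Holds (P : Atom L) {M : Type u} [L.Structure M] (s : ℕ → M) : Prop :=
  FirstOrder.Language.Structure.RelMap P.rel fun i => (P.args i).realize s

end Atom

/-- A literal: the atom `P` if `pos = true`, its negation `¬P` if `pos = false`. -/
structure Literal (L : FirstOrder.Language.{u, v}) where
  pos : Bool
  atom : Atom L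

namespace Literal

variable {L : FirstOrder.Language.{u, v}}

def subst (l : Literal L) (σ : Subst L) : Literal L := ⟨l.pos, l.atom.subst σ⟩

def Holds (l : Literal L) {M : Type u} [L.Structure M] (s : ℕ → M) : Prop :=
  if l.pos = true then l.atom.Holds s else ¬ l.atom.Holds s

end Literal

/-- A clause: a finite multiset of literals, read as their disjunction, with its free variables
universally quantified. The empty clause is `0`. -/
abbrev Clause (L : FirstOrder.Language.{u, v}) := Multiset (Literal L)

namespace Clause

variable {L : FirstOrder.Language.{u, v}}

def subst (C : Clause L) (σ : Subst L) : Clause L := C.map fun l => l.subst σ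

def vars (C : Clause L) : Set ℕ := {x | ∃ l ∈ C, x ∈ l.atom.vars}

/-- The set of atoms of the literals of `C`. -/
def atoms (C : Clause L) : Set (Atom L) := {P | ∃ l ∈ C, l.atom = P}

/-- The universal closure of `C` holds in `M`. -/
def ValidIn (C : Clause L) (M : Type u) [L.Structure M] : Prop :=
  ∀ s : ℕ → M, ∃ l ∈ C, l.Holds s

end Clause

/-- A set of clauses is unsatisfiable if it has no (non-empty) model. Models are taken in the
universe of the function symbols, where the term models live. -/
def Unsatisfiable {L : FirstOrder.Language.{u, v}} (S : Set (Clause L)) : Prop :=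
  ∀ (M : Type u) [Nonempty M] [L.Structure M], ¬ ∀ C ∈ S, C.ValidIn M

/-- A clause with one selected literal; `rest` lists the other literals. -/
structure OneWayClause (L : FirstOrder.Language.{u, v}) where
  selected : Literal L
  rest : List (Literal L)

namespace OneWayClause

variable {L : FirstOrder.Language.{u, v}}

/-- The underlying clause, where the selection is forgotten. -/
def toClause (c : OneWayClause L) : Clause L := c.selected ::ₘ (c.rest : Multiset (Literal L))

def subst (c : OneWayClause L) (σ : Subst L) : OneWayClause L :=
  ⟨c.selected.subst σ, c.rest.map fun l => l.subst σ⟩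

end OneWayClause

/-! ### Polarized resolution modulo -/

/-- `σ` makes all the atoms in `S` equal. -/
def IsUnifier {L : FirstOrder.Language.{u, v}} (σ : Subst L) (S : Set (Atom L)) : Prop :=
  ∀ P ∈ S, ∀ Q ∈ S, P.subst σ = Q.subst σ

/-- `σ` is a most general unifier of `S`: every unifier of `S` factors through `σ`. -/
def IsMGU {L : FirstOrder.Language.{u, v}} (σ : Subst L) (S : Set (Atom L)) : Prop :=
  IsUnifier σ S ∧ ∀ τ : Subst L, IsUnifier τ S → ∃ δ : Subst L, ∀ n, τ n = (σ n).subst δ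

/-- `Derives T U C`: polarized resolution modulo with the set `T` of one-way clauses derives the
(ordinary) clause `C` from the set `U` of ordinary clauses. Resolution is Robinson's rule:
premises are renamed apart, and a non-empty group of literals of a premise may be unified and
resolved upon at once. Two ordinary clauses can be resolved without restriction. An ordinary
clause and a one-way clause can be resolved only if the literal resolved upon in the one-way
clause is its selected one. Two one-way clauses are never resolved. -/
inductive Derives {L : FirstOrder.Language.{u, v}} (T : Set (OneWayClause L)) (U : Set (Clause L)) :
    Clause L → Prop
  | input (C : Clause L) (hC : C ∈ U) : Derives T U C
  | rename (C : Clause L) (ρ : Equiv.Perm ℕ) (hC : Derives T U C) :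
      Derives T U (C.subst (renameSubst ρ))
  | resolve (K C N D : Clause L) (σ : Subst L)
      (hK : K ≠ 0) (hN : N ≠ 0)
      (hKpos : ∀ l ∈ K, l.pos = true) (hNneg : ∀ l ∈ N, l.pos = false)
      (hapart : Disjoint (Clause.vars (K + C)) (Clause.vars (N + D)))
      (hσ : IsMGU σ (Clause.atoms (K + N)))
      (h₁ : Derives T U (K + C)) (h₂ : Derives T U (N + D)) :
      Derives T U (Clause.subst (C + D) σ)
  | resolveOneWay (c : OneWayClause L) (ρ : Equiv.Perm ℕ) (K D : Clause L) (σ : Subst L)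
      (hc : c ∈ T) (hK : K ≠ 0)
      (hopp : ∀ l ∈ K, l.pos = !c.selected.pos)
      (hapart : Disjoint (Clause.vars (c.subst (renameSubst ρ)).toClause) (Clause.vars (K + D)))
      (hσ : IsMGU σ (insert (c.subst (renameSubst ρ)).selected.atom (Clause.atoms K)))
      (h : Derives T U (K + D)) :
      Derives T U
        (Clause.subst (((c.subst (renameSubst ρ)).rest : Multiset (Literal L)) + D) σ)

/-- Polarized resolution modulo with the set `T` of one-way clauses is (refutationally) complete:
whenever `T` together with a set `U` of ordinary clauses is unsatisfiable, it derives the empty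
clause. -/
def ResolutionComplete {L : FirstOrder.Language.{u, v}} (T : Set (OneWayClause L)) : Prop :=
  ∀ U : Set (Clause L), Unsatisfiable (OneWayClause.toClause '' T ∪ U) → Derives T U 0

/-! ### Propositions and polarized rewriting -/

/-- Propositions built from atoms with `⊥`, `¬`, `∨`, `∀`, in de Bruijn notation: in `all A` the
variable `0` of `A` is bound, and the variable `n + 1` of `A` is the variable `n` outside. -/
inductive Fml (L : FirstOrder.Language.{u, v}) where
  | bot : Fml L
  | atom (P : Atom L) : Fml L
  | neg (A : Fml L) : Fml L
  | or (A B : Fml L) : Fml L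
  | all (A : Fml L) : Fml L

/-- The substitution that acts as `σ` under one more binder. -/
def Subst.up {L : FirstOrder.Language.{u, v}} (σ : Subst L) : Subst L
  | 0 => FirstOrder.Language.Term.var 0
  | n + 1 => (σ n).relabel Nat.succ

namespace Fml

variable {L : FirstOrder.Language.{u, v}}

/-- Capture-avoiding substitution. -/
def subst : Fml L → Subst L → Fml L
  | bot, _ => bot
  | atom P, σ => atom (P.subst σ)
  | neg A, σ => neg (A.subst σ)
  | or A B, σ => or (A.subst σ) (B.subst σ)
  | all A, σ => all (A.subst σ.up)

/-- The substitution `(t/x)B` for the bound variable `x` of `all B`. -/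
def inst (B : Fml L) (t : L.Term ℕ) : Fml L :=
  B.subst fun
    | 0 => t
    | n + 1 => FirstOrder.Language.Term.var n

/-- `A` seen under one more binder, whose variable does not occur in it. -/
def shift (A : Fml L) : Fml L := A.subst (renameSubst Nat.succ)

/-- The proposition `∀ x A`, for a named variable `x`. -/
def allVar (x : ℕ) (A : Fml L) : Fml L :=
  all (A.subst fun y =>
    if y = x then FirstOrder.Language.Term.var 0 else FirstOrder.Language.Term.var (y + 1))

end Fml

def Literal.toFml {L : FirstOrder.Language.{u, v}} (l : Literal L) : Fml L :=
  if l.pos = true then Fml.atom l.atom else Fml.neg (Fml.atom l.atom)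

/-- `C₁ ∨ ... ∨ Cₚ`, which is `⊥` if `p = 0` and `C₁` if `p = 1`. -/
def disj {L : FirstOrder.Language.{u, v}} : List (Literal L) → Fml L
  | [] => Fml.bot
  | [l] => l.toFml
  | l :: m :: ls => Fml.or l.toFml (disj (m :: ls))

/-- A polarized rewrite rule: positive if `pol = true`, negative if `pol = false`. -/
structure Rule (L : FirstOrder.Language.{u, v}) where
  pol : Bool
  lhs : Atom L
  rhs : Fml L

/-- One step of polarized rewriting, at polarity `+` (`true`) or `-` (`false`): a rule of that
polarity applies to an atom, and negation swaps the polarities. -/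
inductive Step {L : FirstOrder.Language.{u, v}} (R : Set (Rule L)) : Bool → Fml L → Fml L → Prop
  | rule (r : Rule L) (hr : r ∈ R) (σ : Subst L) :
      Step R r.pol (Fml.atom (r.lhs.subst σ)) (r.rhs.subst σ)
  | neg (p : Bool) (A A' : Fml L) (h : Step R (!p) A A') : Step R p (Fml.neg A) (Fml.neg A')
  | orLeft (p : Bool) (A A' B : Fml L) (h : Step R p A A') :
      Step R p (Fml.or A B) (Fml.or A' B)
  | orRight (p : Bool) (A B B' : Fml L) (h : Step R p B B') :
      Step R p (Fml.or A B) (Fml.or A B')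
  | all (p : Bool) (A A' : Fml L) (h : Step R p A A') : Step R p (Fml.all A) (Fml.all A')

/-- `A ⟶₋* B`. -/
def RedNeg {L : FirstOrder.Language.{u, v}} (R : Set (Rule L)) : Fml L → Fml L → Prop :=
  Relation.ReflTransGen (Step R false)

/-- `A ⟶₊* B`. -/
def RedPos {L : FirstOrder.Language.{u, v}} (R : Set (Rule L)) : Fml L → Fml L → Prop :=
  Relation.ReflTransGen (Step R true)

namespace OneWayClause

variable {L : FirstOrder.Language.{u, v}}

/-- The variables `x₁, ..., xₙ` that occur in the other literals but not in the selected one. -/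
def extraVars (c : OneWayClause L) : List ℕ :=
  ((c.rest.foldr (fun l s => l.atom.vars ∪ s) ∅) \ c.selected.atom.vars).sort

/-- The proposition `∀ x₁ ... ∀ xₙ (C₁ ∨ ... ∨ Cₚ)`. -/
def body (c : OneWayClause L) : Fml L := c.extraVars.foldr Fml.allVar (disj c.rest)

/-- The rewrite rule of a one-way clause: `P ⟶₋ ∀ x₁ ... ∀ xₙ (C₁ ∨ ... ∨ Cₚ)` if the selected
literal is `¬P`, and `P ⟶₊ ¬ ∀ x₁ ... ∀ xₙ (C₁ ∨ ... ∨ Cₚ)` if it is `P`. -/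
def rule (c : OneWayClause L) : Rule L where
  pol := c.selected.pos
  lhs := c.selected.atom
  rhs := if c.selected.pos = true then Fml.neg c.body else c.body

end OneWayClause

/-- The polarized rewrite system associated with a set of one-way clauses. -/
def rewriteSystem {L : FirstOrder.Language.{u, v}} (T : Set (OneWayClause L)) : Set (Rule L) :=
  OneWayClause.rule '' T

/-! ### Polarized sequent calculus modulo -/

/-- `Sequent R c Γ Δ`: the sequent `Γ ⊢ Δ` has a proof in the polarized sequent calculus modulo
`R`, where the cut rule may be used if and only if `c` holds. -/
inductive Sequent {L : FirstOrder.Language.{u, v}} (R : Set (Rule L)) (c : Prop) :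
    Multiset (Fml L) → Multiset (Fml L) → Prop
  | ax (A B : Fml L) (P : Atom L) (hA : RedNeg R A (Fml.atom P)) (hB : RedPos R B (Fml.atom P)) :
      Sequent R c {A} {B}
  | cut (hcut : c) (Γ Δ : Multiset (Fml L)) (A B C : Fml L)
      (hB : RedNeg R A B) (hC : RedPos R A C)
      (h₁ : Sequent R c (B ::ₘ Γ) Δ) (h₂ : Sequent R c Γ (C ::ₘ Δ)) : Sequent R c Γ Δ
  | contrLeft (Γ Δ : Multiset (Fml L)) (A B C : Fml L)
      (hB : RedNeg R A B) (hC : RedNeg R A C)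
      (h : Sequent R c (B ::ₘ C ::ₘ Γ) Δ) : Sequent R c (A ::ₘ Γ) Δ
  | contrRight (Γ Δ : Multiset (Fml L)) (A B C : Fml L)
      (hB : RedPos R A B) (hC : RedPos R A C)
      (h : Sequent R c Γ (B ::ₘ C ::ₘ Δ)) : Sequent R c Γ (A ::ₘ Δ)
  | weakLeft (Γ Δ : Multiset (Fml L)) (A : Fml L) (h : Sequent R c Γ Δ) : Sequent R c (A ::ₘ Γ) Δ
  | weakRight (Γ Δ : Multiset (Fml L)) (A : Fml L) (h : Sequent R c Γ Δ) : Sequent R c Γ (A ::ₘ Δ)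
  | botLeft (Γ Δ : Multiset (Fml L)) (A : Fml L) (hA : RedNeg R A Fml.bot) :
      Sequent R c (A ::ₘ Γ) Δ
  | negLeft (Γ Δ : Multiset (Fml L)) (A B : Fml L) (hA : RedNeg R A (Fml.neg B))
      (h : Sequent R c Γ (B ::ₘ Δ)) : Sequent R c (A ::ₘ Γ) Δ
  | negRight (Γ Δ : Multiset (Fml L)) (A B : Fml L) (hA : RedPos R A (Fml.neg B))
      (h : Sequent R c (B ::ₘ Γ) Δ) : Sequent R c Γ (A ::ₘ Δ)
  | orLeft (Γ Δ : Multiset (Fml L)) (A B C : Fml L) (hA : RedNeg R A (Fml.or B C))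
      (h₁ : Sequent R c (B ::ₘ Γ) Δ) (h₂ : Sequent R c (C ::ₘ Γ) Δ) : Sequent R c (A ::ₘ Γ) Δ
  | orRight (Γ Δ : Multiset (Fml L)) (A B C : Fml L) (hA : RedPos R A (Fml.or B C))
      (h : Sequent R c Γ (B ::ₘ C ::ₘ Δ)) : Sequent R c Γ (A ::ₘ Δ)
  | allLeft (Γ Δ : Multiset (Fml L)) (A B C : Fml L) (t : L.Term ℕ)
      (hA : RedNeg R A (Fml.all B)) (hC : RedNeg R (B.inst t) C)
      (h : Sequent R c (C ::ₘ Γ) Δ) : Sequent R c (A ::ₘ Γ) Δ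
  | allRight (Γ Δ : Multiset (Fml L)) (A B : Fml L) (hA : RedPos R A (Fml.all B))
      (h : Sequent R c (Γ.map Fml.shift) (B ::ₘ Δ.map Fml.shift)) : Sequent R c Γ (A ::ₘ Δ)

/-- The polarized sequent calculus modulo `R` admits the cut rule: every sequent that has a proof
has a proof without cuts. -/
def AdmitsCut {L : FirstOrder.Language.{u, v}} (R : Set (Rule L)) : Prop :=
  ∀ Γ Δ : Multiset (Fml L), Sequent R True Γ Δ → Sequent R False Γ Δ

/-! ### Occurrences of function symbols -/

def TermUses {L : FirstOrder.Language.{u, v}} {n : ℕ} (f : L.Functions n) : L.Term ℕ → Prop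
  | .var _ => False
  | @FirstOrder.Language.Term.func _ _ m g ts =>
      (⟨n, f⟩ : Σ k, L.Functions k) = ⟨m, g⟩ ∨ ∃ i, TermUses f (ts i)

/-- The function symbol (constant, if `n = 0`) `f` occurs in a clause of `T`. -/
def OccursIn {L : FirstOrder.Language.{u, v}} {n : ℕ} (f : L.Functions n)
    (T : Set (OneWayClause L)) : Prop :=
  ∃ c ∈ T, ∃ l ∈ c.toClause, ∃ i, TermUses f (l.atom.args i)

end PolRes

namespace PolRes

open FirstOrder.Language (Term)

/-! ### Substitutions and environments -/

section Terms

variable {L : FirstOrder.Language.{u, v}} {α β γ : Type*}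

/-! Cut admissibility gives completeness by reading proofs as derivations. If `T ∪ U` is
unsatisfiable, Herbrand's theorem yields finitely many instances that no propositional valuation
satisfies. Cuts on all their atoms leave branches in which some instance is refuted, by decomposing
it if it comes from `U` and by rewriting if it comes from `T` (`PS.of_finite_unsat`, `PS.oneWay`).
Eliminating these cuts leaves a cut-free proof, which translates into ground resolution
(`Sequent.groundDerives`): a proposition stands for its ground clauses, and rewriting an atom is
resolution against a one-way clause. No Skolemization is needed, since the hypotheses are
quantifier-free and the rules only create quantifiers that are decomposed on the left.
`GroundDerives.lift` then replaces instances by most general unifiers.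

Conversely, completeness gives cut admissibility by a semantic argument. A sequent without a
cut-free proof extends to a Hintikka set `H` of signed propositions over parameters, also closed
under `T`: if `H` contradicts the selected literal of an instance, it contains one of the other
literals. Without cut, `H` need not decide every atom, so it need not determine a model of `T`; this
is the gap that completeness fills. A valuation that extends the literals of `H` and satisfies `T`
would refute the sequent, which soundness excludes if the sequent is provable with cuts. By
compactness, finitely many literals of `H` already contradict `T`. Written as unit clauses, with
fresh constants for the parameters, they yield the empty clause by completeness. But every clause
derivable from them has, under each assignment, a literal in `H` (`Saturated.exists_hasLit`):
resolving two ordinary clauses preserves this because `H` is consistent, resolving with a one-way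
clause because `H` is closed under `T`. The empty clause has no literal. -/

theorem term_subst_subst (t : L.Term α) (σ : α → L.Term β) (τ : β → L.Term γ) :
    (t.subst σ).subst τ = t.subst fun a => (σ a).subst τ := by
  induction t with
  | var a => rfl
  | func f ts ih => simp [Term.subst, ih]

theorem term_relabel_eq_subst (t : L.Term α) (f : α → β) :
    t.relabel f = t.subst fun a => Term.var (f a) := by
  induction t with
  | var a => rfl
  | func f ts ih => simp [Term.subst, ih]

theorem term_subst_var (t : L.Term α) : t.subst Term.var = t := by
  induction t with
  | var a => rfl
  | func f ts ih => simp [Term.subst, ih]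

theorem term_subst_congr [DecidableEq α] {t : L.Term α} {σ τ : α → L.Term β}
    (h : ∀ x ∈ t.varFinset, σ x = τ x) : t.subst σ = t.subst τ := by
  induction t with
  | var a => exact h a (by simp)
  | func f ts ih =>
    simp only [Term.subst, Term.func.injEq, heq_eq_eq, true_and]
    exact funext fun i => ih i fun x hx => h x (by simpa using ⟨i, hx⟩)

theorem term_realize_congr [DecidableEq α] {M : Type*} [L.Structure M] {t : L.Term α}
    {s s' : α → M} (h : ∀ x ∈ t.varFinset, s x = s' x) : t.realize s = t.realize s' := by
  induction t with
  | var a => exact h a (by simp)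
  | func f ts ih =>
    simp only [Term.realize]
    congr 1
    exact funext fun i => ih i fun x hx => h x (by simpa using ⟨i, hx⟩)

/-- The environment that maps `0` to `a` and `n + 1` to `s n`. -/
def scons {X : Type*} (a : X) (s : ℕ → X) : ℕ → X
  | 0 => a
  | n + 1 => s n

end Terms

variable {L : FirstOrder.Language.{u, v}}

theorem Atom.subst_subst (P : Atom L) (σ τ : Subst L) :
    (P.subst σ).subst τ = P.subst fun n => (σ n).subst τ := by
  simp [Atom.subst, term_subst_subst]

theorem Atom.subst_var (P : Atom L) : P.subst Term.var = P := by
  simp [Atom.subst, term_subst_var]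

theorem Atom.subst_congr {P : Atom L} {σ τ : Subst L} (h : ∀ x ∈ P.vars, σ x = τ x) :
    P.subst σ = P.subst τ := by
  simp only [Atom.subst, Atom.mk.injEq, heq_eq_eq, true_and]
  exact funext fun i => term_subst_congr fun x hx =>
    h x (Finset.mem_biUnion.2 ⟨i, Finset.mem_univ i, hx⟩)

theorem Literal.subst_subst (l : Literal L) (σ τ : Subst L) :
    (l.subst σ).subst τ = l.subst fun n => (σ n).subst τ := by
  simp [Literal.subst, Atom.subst_subst]

theorem Literal.subst_var (l : Literal L) : l.subst Term.var = l := by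
  simp [Literal.subst, Atom.subst_var]

theorem Literal.subst_congr {l : Literal L} {σ τ : Subst L} (h : ∀ x ∈ l.atom.vars, σ x = τ x) :
    l.subst σ = l.subst τ := by
  simp [Literal.subst, Atom.subst_congr h]

theorem up_subst_scons (σ : Subst L) (t : L.Term ℕ) (τ : Subst L) :
    (fun n => (σ.up n).subst (scons t τ)) = scons t fun n => (σ n).subst τ := by
  funext n
  cases n with
  | zero => rfl
  | succ n => simp [Subst.up, scons, term_relabel_eq_subst, term_subst_subst, Term.subst]

theorem up_subst_up (σ τ : Subst L) :
    (fun n => (σ.up n).subst τ.up) = Subst.up fun n => (σ n).subst τ := by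
  funext n
  cases n with
  | zero => rfl
  | succ n => simp [Subst.up, term_relabel_eq_subst, term_subst_subst, Term.subst]

theorem up_var : Subst.up (L := L) Term.var = Term.var := by
  funext n
  cases n <;> rfl

namespace Fml

theorem subst_subst (A : Fml L) (σ τ : Subst L) :
    (A.subst σ).subst τ = A.subst fun n => (σ n).subst τ := by
  induction A generalizing σ τ with
  | bot => rfl
  | atom P => simp [subst, Atom.subst_subst]
  | neg A ih => simp [subst, ih]
  | or A B ihA ihB => simp [subst, ihA, ihB]
  | all A ih => simp [subst, ih, up_subst_up]

theorem subst_var (A : Fml L) : A.subst Term.var = A := by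
  induction A with
  | bot => rfl
  | atom P => simp [subst, Atom.subst_var]
  | neg A ih => simp [subst, ih]
  | or A B ihA ihB => simp [subst, ihA, ihB]
  | all A ih => simp [subst, ih, up_var]

theorem inst_eq (B : Fml L) (t : L.Term ℕ) : B.inst t = B.subst (scons t Term.var) := by
  unfold inst
  congr 1

/-- Going under the binder and then instantiating is a single substitution; this matches the ∀ rules
with environments extended by `scons`. -/
theorem inst_subst_up (B : Fml L) (σ : Subst L) (t : L.Term ℕ) :
    (B.subst σ.up).inst t = B.subst (scons t σ) := by
  rw [inst_eq, subst_subst, up_subst_scons]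
  simp [term_subst_var]

/-- The substitution under the binder of `allVar x`. -/
theorem allVar_subst_inst (x : ℕ) (A : Fml L) (σ : Subst L) :
    ∃ B, (allVar x A).subst σ = all B ∧ ∀ t, B.inst t = A.subst (Function.update σ x t) := by
  refine ⟨_, rfl, fun t => ?_⟩
  rw [inst_subst_up, subst_subst]
  congr 1
  funext n
  by_cases h : n = x
  · subst h
    simp [Term.subst, scons]
  · simp [Term.subst, scons, h]

/-! ### Truth in a structure -/

/-- Truth of a proposition in a structure. -/
def Realize {M : Type*} [L.Structure M] : Fml L → (ℕ → M) → Prop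
  | bot, _ => False
  | atom P, s => FirstOrder.Language.Structure.RelMap P.rel fun i => (P.args i).realize s
  | neg A, s => ¬ Realize A s
  | or A B, s => Realize A s ∨ Realize B s
  | all A, s => ∀ a, Realize A (scons a s)

section Realize

variable {M : Type*} [L.Structure M]

theorem realize_subst (A : Fml L) (σ : Subst L) (s : ℕ → M) :
    (A.subst σ).Realize s ↔ A.Realize fun n => (σ n).realize s := by
  induction A generalizing σ s with
  | bot => rfl
  | atom P => simp [subst, Atom.subst, Realize]
  | neg A ih => simp [subst, Realize, ih]
  | or A B ihA ihB => simp [subst, Realize, ihA, ihB]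
  | all A ih =>
    simp only [subst, Realize, ih]
    refine forall_congr' fun a => iff_of_eq (congrArg _ ?_)
    funext n
    cases n with
    | zero => rfl
    | succ n =>
      simp only [Subst.up, scons, Term.realize_relabel]
      rfl

theorem realize_inst (A : Fml L) (t : L.Term ℕ) (s : ℕ → M) :
    (A.inst t).Realize s ↔ A.Realize (scons (t.realize s) s) := by
  rw [inst_eq, realize_subst]
  refine iff_of_eq (congrArg _ ?_)
  funext n
  cases n <;> rfl

theorem realize_shift (A : Fml L) (a : M) (s : ℕ → M) :
    A.shift.Realize (scons a s) ↔ A.Realize s := by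
  rw [shift, realize_subst]
  rfl

theorem realize_allVar (x : ℕ) (A : Fml L) (s : ℕ → M) :
    (allVar x A).Realize s ↔ ∀ a, A.Realize (Function.update s x a) := by
  simp only [allVar, Realize, realize_subst]
  refine forall_congr' fun a => iff_of_eq (congrArg _ ?_)
  funext n
  by_cases h : n = x
  · subst h
    simp [scons]
  · simp [scons, h]

theorem realize_foldr_allVar (xs : List ℕ) (A : Fml L) (s : ℕ → M) :
    (xs.foldr allVar A).Realize s ↔ ∀ s' : ℕ → M, (∀ x ∉ xs, s' x = s x) → A.Realize s' := by
  induction xs generalizing s with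
  | nil =>
    refine ⟨fun h s' hs => ?_, fun h => h s fun _ _ => rfl⟩
    rwa [show s' = s from funext fun x => hs x (by simp)]
  | cons x xs ih =>
    simp only [List.foldr_cons, realize_allVar, ih]
    -- The value for the outer quantifier is read off the target assignment `s'`.
    refine ⟨fun h s' hs => h (s' x) s' fun y hy => ?_, fun h a s' hs => h s' fun y hy => ?_⟩
    · by_cases hyx : y = x
      · subst hyx; simp
      · simp [hyx, hs y (by simp [hyx, hy])]
    · rw [List.mem_cons, not_or] at hy
      rw [hs y hy.2]
      simp [hy.1]

end Realize

end Fml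

theorem realize_disj {M : Type*} [L.Structure M] (ls : List (Literal L)) (s : ℕ → M) :
    (disj ls).Realize s ↔ ∃ l ∈ ls, l.toFml.Realize s := by
  induction ls with
  | nil => simp [disj, Fml.Realize]
  | cons l ls ih =>
    cases ls with
    | nil => simp [disj]
    | cons m ls => simp only [disj, Fml.Realize, ih]; simp

theorem realize_atom_congr {M : Type*} [L.Structure M] {P : Atom L} {s s' : ℕ → M}
    (h : ∀ x ∈ P.vars, s x = s' x) :
    (Fml.atom P).Realize s ↔ (Fml.atom P).Realize s' := by
  simp only [Fml.Realize]
  refine iff_of_eq (congrArg _ (funext fun i => term_realize_congr fun x hx => h x ?_))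
  exact Finset.mem_biUnion.2 ⟨i, Finset.mem_univ i, hx⟩

theorem Literal.toFml_subst (l : Literal L) (σ : Subst L) :
    (l.subst σ).toFml = l.toFml.subst σ := by
  unfold Literal.toFml Literal.subst
  split <;> rfl

namespace OneWayClause

theorem mem_extraVars (c : OneWayClause L) (x : ℕ) :
    x ∈ c.extraVars ↔ (∃ l ∈ c.rest, x ∈ l.atom.vars) ∧ x ∉ c.selected.atom.vars := by
  have h (ls : List (Literal L)) :
      x ∈ ls.foldr (fun l s => l.atom.vars ∪ s) ∅ ↔ ∃ l ∈ ls, x ∈ l.atom.vars := by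
    induction ls with
    | nil => simp
    | cons l ls ih => simp [ih]
  simp [extraVars, h]

/-- A one-way clause is true in a structure, under the assignment `s`. -/
def ValidAt (c : OneWayClause L) {M : Type*} [L.Structure M] (s : ℕ → M) : Prop :=
  c.selected.toFml.Realize s ∨ ∃ l ∈ c.rest, l.toFml.Realize s

end OneWayClause

/-! ### Soundness of the sequent calculus -/

theorem exists_mem_cons {X : Type*} {p : X → Prop} {a : X} {s : Multiset X} :
    (∃ x ∈ a ::ₘ s, p x) ↔ p a ∨ ∃ x ∈ s, p x := by
  simp

section Soundness

variable {T : Set (OneWayClause L)} {M : Type*} [L.Structure M]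

/-- A negative rule is an implication `P → body` and a positive one is `¬ body → P`; each is the
one-way clause itself. The two polarities are proved together because negation exchanges them. -/
theorem realize_step (hT : ∀ c ∈ T, ∀ s : ℕ → M, c.ValidAt s) {p : Bool} {A B : Fml L}
    (h : Step (rewriteSystem T) p A B) (s : ℕ → M) :
    (p = false → A.Realize s → B.Realize s) ∧ (p = true → B.Realize s → A.Realize s) := by
  induction h generalizing s with
  | rule r hr σ =>
    obtain ⟨c, hc, rfl⟩ := hr
    have key : ¬ c.selected.toFml.Realize (fun n => (σ n).realize s) →
        (c.body.subst σ).Realize s := by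
      intro hL
      rw [Fml.realize_subst, OneWayClause.body, Fml.realize_foldr_allVar]
      intro s' hs'
      rw [realize_disj]
      -- The quantified variables do not occur in the selected atom, so its truth value is the same
      -- under `s'`.
      refine (hT c hc s').resolve_left fun h => hL ?_
      have hv : ∀ x ∈ c.selected.atom.vars, s' x = (σ x).realize s := fun x hx =>
        hs' x fun hx' => ((c.mem_extraVars x).1 hx').2 hx
      have := realize_atom_congr hv
      unfold Literal.toFml at h ⊢
      split_ifs at h ⊢
      · exact this.1 h
      · exact fun h' => h (this.2 h')
    unfold Literal.toFml at key
    constructor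
    · intro hp hA
      have hp' : c.selected.pos = false := hp
      simp only [hp', Bool.false_eq_true, if_false] at key
      simp only [OneWayClause.rule, hp', Bool.false_eq_true, if_false]
      refine key fun h => h ?_
      rwa [← Fml.realize_subst]
    · intro hp hB
      have hp' : c.selected.pos = true := hp
      simp only [hp', if_true] at key
      simp only [OneWayClause.rule, hp', if_true] at hB
      by_contra hA
      refine hB (key fun h => hA ?_)
      rw [← Fml.realize_subst] at h
      exact h
  | neg p A A' h ih =>
    have := ih s
    cases p <;> simp_all [Fml.Realize] <;> tauto
  | orLeft p A A' B h ih =>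
    have := ih s
    cases p <;> simp_all [Fml.Realize] <;> tauto
  | orRight p A A' B h ih =>
    have := ih s
    cases p <;> simp_all [Fml.Realize] <;> tauto
  | all p A A' h ih =>
    exact ⟨fun hp h a => (ih _).1 hp (h a), fun hp h a => (ih _).2 hp (h a)⟩

theorem realize_redNeg (hT : ∀ c ∈ T, ∀ s : ℕ → M, c.ValidAt s) {A B : Fml L}
    (h : RedNeg (rewriteSystem T) A B) (s : ℕ → M) : A.Realize s → B.Realize s := by
  induction h with
  | refl => exact id
  | tail _ h ih => exact fun hA => (realize_step hT h s).1 rfl (ih hA)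

theorem realize_redPos (hT : ∀ c ∈ T, ∀ s : ℕ → M, c.ValidAt s) {A B : Fml L}
    (h : RedPos (rewriteSystem T) A B) (s : ℕ → M) : B.Realize s → A.Realize s := by
  induction h with
  | refl => exact id
  | tail _ h ih => exact fun hA => ih ((realize_step hT h s).2 rfl hA)

/-- Soundness: a provable sequent holds in every structure in which the one-way clauses hold. -/
theorem Sequent.realize (hT : ∀ c ∈ T, ∀ s : ℕ → M, c.ValidAt s) {c : Prop}
    {Γ Δ : Multiset (Fml L)} (h : Sequent (rewriteSystem T) c Γ Δ) (s : ℕ → M)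
    (hΓ : ∀ A ∈ Γ, A.Realize s) : ∃ A ∈ Δ, A.Realize s := by
  induction h generalizing s with
  | ax A B P hA hB =>
    exact ⟨B, by simp, realize_redPos hT hB s (realize_redNeg hT hA s (hΓ A (by simp)))⟩
  | cut _ Γ Δ A B C hB hC _ _ ih₁ ih₂ =>
    have h₂ := ih₂ s hΓ
    rw [exists_mem_cons] at h₂
    refine h₂.elim (fun h => ih₁ s ?_) id
    rw [Multiset.forall_mem_cons]
    exact ⟨realize_redNeg hT hB s (realize_redPos hT hC s h), hΓ⟩
  | contrLeft Γ Δ A B C hB hC _ ih =>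
    rw [Multiset.forall_mem_cons] at hΓ
    refine ih s ?_
    rw [Multiset.forall_mem_cons, Multiset.forall_mem_cons]
    exact ⟨realize_redNeg hT hB s hΓ.1, realize_redNeg hT hC s hΓ.1, hΓ.2⟩
  | contrRight Γ Δ A B C hB hC _ ih =>
    have h := ih s hΓ
    rw [exists_mem_cons, exists_mem_cons] at h
    rw [exists_mem_cons]
    exact h.elim (fun h => .inl (realize_redPos hT hB s h)) fun h =>
      h.imp_left (realize_redPos hT hC s)
  | weakLeft Γ Δ A _ ih => exact ih s fun B hB => hΓ B (Multiset.mem_cons_of_mem hB)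
  | weakRight Γ Δ A _ ih =>
    obtain ⟨B, hB, h⟩ := ih s hΓ
    exact ⟨B, Multiset.mem_cons_of_mem hB, h⟩
  | botLeft Γ Δ A hA => exact (realize_redNeg hT hA s (hΓ A (by simp))).elim
  | negLeft Γ Δ A B hA _ ih =>
    rw [Multiset.forall_mem_cons] at hΓ
    have h := ih s hΓ.2
    rw [exists_mem_cons] at h
    exact h.resolve_left (realize_redNeg hT hA s hΓ.1)
  | negRight Γ Δ A B hA _ ih =>
    rw [exists_mem_cons]
    by_cases hB : B.Realize s
    · refine .inr (ih s ?_)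
      rw [Multiset.forall_mem_cons]
      exact ⟨hB, hΓ⟩
    · exact .inl (realize_redPos hT hA s hB)
  | orLeft Γ Δ A B C hA _ _ ih₁ ih₂ =>
    rw [Multiset.forall_mem_cons] at hΓ
    refine (realize_redNeg hT hA s hΓ.1).elim (fun h => ih₁ s ?_) fun h => ih₂ s ?_
    all_goals
      rw [Multiset.forall_mem_cons]
      exact ⟨h, hΓ.2⟩
  | orRight Γ Δ A B C hA _ ih =>
    have h := ih s hΓ
    rw [exists_mem_cons, exists_mem_cons] at h
    rw [exists_mem_cons]
    exact h.elim (fun h => .inl (realize_redPos hT hA s (.inl h))) fun h =>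
      h.imp_left fun h => realize_redPos hT hA s (.inr h)
  | allLeft Γ Δ A B C t hA hC _ ih =>
    rw [Multiset.forall_mem_cons] at hΓ
    refine ih s ?_
    rw [Multiset.forall_mem_cons]
    refine ⟨realize_redNeg hT hC s ?_, hΓ.2⟩
    rw [Fml.realize_inst]
    exact realize_redNeg hT hA s hΓ.1 _
  | allRight Γ Δ A B hA _ ih =>
    rw [exists_mem_cons]
    by_contra! hcon
    refine hcon.1 (realize_redPos hT hA s fun a => ?_)
    have h := ih (scons a s) fun D hD => by
      obtain ⟨E, hE, rfl⟩ := Multiset.mem_map.1 hD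
      exact (Fml.realize_shift E a s).2 (hΓ E hE)
    rw [exists_mem_cons] at h
    refine h.resolve_right ?_
    rintro ⟨D, hD, hs⟩
    obtain ⟨E, hE, rfl⟩ := Multiset.mem_map.1 hD
    exact hcon.2 E hE ((Fml.realize_shift E a s).1 hs)

end Soundness

/-! ### Provability from sets of propositions -/

/-- Some sequent whose members are taken from `Γ` and `Δ` is provable. -/
def PS (R : Set (Rule L)) (c : Prop) (Γ Δ : Set (Fml L)) : Prop :=
  ∃ Γ' Δ' : Multiset (Fml L), (∀ A ∈ Γ', A ∈ Γ) ∧ (∀ A ∈ Δ', A ∈ Δ) ∧ Sequent R c Γ' Δ'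

section Structural

variable {R : Set (Rule L)} {c : Prop}

theorem Sequent.weaken {Γ Δ : Multiset (Fml L)} (h : Sequent R c Γ Δ) (Γ₀ Δ₀ : Multiset (Fml L)) :
    Sequent R c (Γ₀ + Γ) (Δ₀ + Δ) := by
  have h₁ : Sequent R c (Γ₀ + Γ) Δ := by
    induction Γ₀ using Multiset.induction with
    | empty => simpa using h
    | cons A Γ₀ ih => rw [Multiset.cons_add]; exact .weakLeft _ _ _ ih
  induction Δ₀ using Multiset.induction with
  | empty => simpa using h₁
  | cons A Δ₀ ih => rw [Multiset.cons_add]; exact .weakRight _ _ _ ih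

theorem Sequent.contract_left {Γ Δ : Multiset (Fml L)} {A : Fml L} (k : ℕ)
    (h : Sequent R c (Multiset.replicate k A + Γ) Δ) : Sequent R c (A ::ₘ Γ) Δ := by
  induction k with
  | zero => simpa using h.weakLeft _ _ A
  | succ k ih =>
    cases k with
    | zero => simpa using h
    | succ k =>
      refine ih ?_
      simp only [Multiset.replicate_succ, Multiset.cons_add] at h ⊢
      exact h.contrLeft _ _ _ _ _ .refl .refl

theorem Sequent.contract_right {Γ Δ : Multiset (Fml L)} {A : Fml L} (k : ℕ)
    (h : Sequent R c Γ (Multiset.replicate k A + Δ)) : Sequent R c Γ (A ::ₘ Δ) := by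
  induction k with
  | zero => simpa using h.weakRight _ _ A
  | succ k ih =>
    cases k with
    | zero => simpa using h
    | succ k =>
      refine ih ?_
      simp only [Multiset.replicate_succ, Multiset.cons_add] at h ⊢
      exact h.contrRight _ _ _ _ _ .refl .refl

/-- Isolating all copies of `a` lets contraction merge them into the one principal formula that a
sequent rule expects. -/
theorem exists_replicate_add {X : Type*} {a : X} {S : Set X} {s : Multiset X}
    (h : ∀ x ∈ s, x ∈ insert a S) :
    ∃ (k : ℕ) (t : Multiset X), s = Multiset.replicate k a + t ∧ ∀ x ∈ t, x ∈ S := by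
  classical
  refine ⟨s.count a, s.filter (· ≠ a), ?_, fun x hx => ?_⟩
  · rw [← Multiset.filter_eq' s a]
    exact (Multiset.filter_add_not (· = a) s).symm
  · rw [Multiset.mem_filter] at hx
    exact (h x hx.1).resolve_left hx.2

theorem PS.mono {Γ Δ Γ' Δ' : Set (Fml L)} (h : PS R c Γ Δ) (hΓ : Γ ⊆ Γ') (hΔ : Δ ⊆ Δ') :
    PS R c Γ' Δ' := by
  obtain ⟨G, D, hG, hD, h⟩ := h
  exact ⟨G, D, fun A hA => hΓ (hG A hA), fun A hA => hΔ (hD A hA), h⟩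

theorem PS.exists_left {Γ Δ : Set (Fml L)} {A : Fml L} (h : PS R c (insert A Γ) Δ) :
    ∃ Γ' Δ' : Multiset (Fml L), (∀ A ∈ Γ', A ∈ Γ) ∧ (∀ A ∈ Δ', A ∈ Δ) ∧
      Sequent R c (A ::ₘ Γ') Δ' := by
  obtain ⟨G, D, hG, hD, h⟩ := h
  obtain ⟨k, G', rfl, hG'⟩ := exists_replicate_add hG
  exact ⟨G', D, hG', hD, h.contract_left k⟩

theorem PS.exists_right {Γ Δ : Set (Fml L)} {A : Fml L} (h : PS R c Γ (insert A Δ)) :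
    ∃ Γ' Δ' : Multiset (Fml L), (∀ A ∈ Γ', A ∈ Γ) ∧ (∀ A ∈ Δ', A ∈ Δ) ∧
      Sequent R c Γ' (A ::ₘ Δ') := by
  obtain ⟨G, D, hG, hD, h⟩ := h
  obtain ⟨k, D', rfl, hD'⟩ := exists_replicate_add hD
  exact ⟨G, D', hG, hD', h.contract_right k⟩

theorem forall_mem_add {X : Type*} {S : Set X} {s t : Multiset X} (hs : ∀ x ∈ s, x ∈ S)
    (ht : ∀ x ∈ t, x ∈ S) : ∀ x ∈ s + t, x ∈ S := fun x hx =>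
  (Multiset.mem_add.1 hx).elim (hs x) (ht x)

theorem forall_mem_cons {X : Type*} {S : Set X} {a : X} {s : Multiset X} (ha : a ∈ S)
    (hs : ∀ x ∈ s, x ∈ S) : ∀ x ∈ a ::ₘ s, x ∈ S :=
  Multiset.forall_mem_cons.2 ⟨ha, hs⟩

variable {Γ Δ : Set (Fml L)}

theorem PS.ax {P : Atom L} (h₁ : Fml.atom P ∈ Γ) (h₂ : Fml.atom P ∈ Δ) : PS R c Γ Δ :=
  ⟨{Fml.atom P}, {Fml.atom P}, by simpa using h₁, by simpa using h₂, .ax _ _ _ .refl .refl⟩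

theorem PS.cut (hc : c) {A : Fml L} (h₁ : PS R c (insert A Γ) Δ) (h₂ : PS R c Γ (insert A Δ)) :
    PS R c Γ Δ := by
  obtain ⟨G₁, D₁, hG₁, hD₁, h₁⟩ := h₁.exists_left
  obtain ⟨G₂, D₂, hG₂, hD₂, h₂⟩ := h₂.exists_right
  refine ⟨G₂ + G₁, D₁ + D₂, forall_mem_add hG₂ hG₁, forall_mem_add hD₁ hD₂,
    .cut hc _ _ A A A .refl .refl ?_ ?_⟩
  · simpa [add_comm] using h₁.weaken G₂ D₂
  · simpa [add_comm] using h₂.weaken G₁ D₁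

/-- The calculus has no conversion rule, but contraction allows rewriting in its premise: weaken by
a second copy of `B` and contract both into `A`. -/
theorem PS.redLeft {A B : Fml L} (hA : A ∈ Γ) (hAB : RedNeg R A B)
    (h : PS R c (insert B Γ) Δ) : PS R c Γ Δ := by
  obtain ⟨G, D, hG, hD, h⟩ := h.exists_left
  exact ⟨A ::ₘ G, D, forall_mem_cons hA hG, hD,
    .contrLeft _ _ _ _ _ hAB hAB (h.weakLeft _ _ B)⟩

theorem PS.redRight {A B : Fml L} (hA : A ∈ Δ) (hAB : RedPos R A B)
    (h : PS R c Γ (insert B Δ)) : PS R c Γ Δ := by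
  obtain ⟨G, D, hG, hD, h⟩ := h.exists_right
  exact ⟨G, A ::ₘ D, hG, forall_mem_cons hA hD,
    .contrRight _ _ _ _ _ hAB hAB (h.weakRight _ _ B)⟩

theorem PS.botLeft (h : Fml.bot ∈ Γ) : PS R c Γ Δ :=
  ⟨Fml.bot ::ₘ 0, 0, by simpa using h, by simp, .botLeft _ _ _ .refl⟩

theorem PS.negLeft {A : Fml L} (hA : Fml.neg A ∈ Γ) (h : PS R c Γ (insert A Δ)) : PS R c Γ Δ := by
  obtain ⟨G, D, hG, hD, h⟩ := h.exists_right
  exact ⟨_, D, forall_mem_cons hA hG, hD, .negLeft _ _ _ _ .refl h⟩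

theorem PS.negRight {A : Fml L} (hA : Fml.neg A ∈ Δ) (h : PS R c (insert A Γ) Δ) : PS R c Γ Δ := by
  obtain ⟨G, D, hG, hD, h⟩ := h.exists_left
  exact ⟨G, _, hG, forall_mem_cons hA hD, .negRight _ _ _ _ .refl h⟩

theorem PS.orLeft {A B : Fml L} (hA : Fml.or A B ∈ Γ) (h₁ : PS R c (insert A Γ) Δ)
    (h₂ : PS R c (insert B Γ) Δ) : PS R c Γ Δ := by
  obtain ⟨G₁, D₁, hG₁, hD₁, h₁⟩ := h₁.exists_left
  obtain ⟨G₂, D₂, hG₂, hD₂, h₂⟩ := h₂.exists_left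
  refine ⟨_, D₁ + D₂, forall_mem_cons hA (forall_mem_add hG₂ hG₁), forall_mem_add hD₁ hD₂,
    .orLeft _ _ _ _ _ .refl ?_ ?_⟩
  · simpa [add_comm] using h₁.weaken G₂ D₂
  · simpa [add_comm] using h₂.weaken G₁ D₁

theorem PS.orRight {A B : Fml L} (hA : Fml.or A B ∈ Δ)
    (h : PS R c Γ (insert A (insert B Δ))) : PS R c Γ Δ := by
  obtain ⟨G, D, hG, hD, h⟩ := h.exists_right
  obtain ⟨k, D', rfl, hD'⟩ := exists_replicate_add hD
  rw [← Multiset.add_cons] at h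
  refine ⟨G, _, hG, forall_mem_cons hA hD', .orRight _ _ _ _ _ .refl ?_⟩
  rw [Multiset.cons_swap]
  exact h.contract_right k

theorem PS.allLeft {A : Fml L} (t : L.Term ℕ) (hA : Fml.all A ∈ Γ)
    (h : PS R c (insert (A.inst t) Γ) Δ) : PS R c Γ Δ := by
  obtain ⟨G, D, hG, hD, h⟩ := h.exists_left
  exact ⟨_, D, forall_mem_cons hA hG, hD, .allLeft _ _ _ _ _ t .refl .refl h⟩

theorem exists_map_eq {X Y : Type*} {f : X → Y} {S : Set X} {s : Multiset Y}
    (h : ∀ y ∈ s, y ∈ f '' S) : ∃ t : Multiset X, t.map f = s ∧ ∀ x ∈ t, x ∈ S := by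
  induction s using Multiset.induction with
  | empty => exact ⟨0, rfl, by simp⟩
  | cons a s ih =>
    obtain ⟨ha, hs⟩ := Multiset.forall_mem_cons.1 h
    obtain ⟨t, rfl, ht⟩ := ih hs
    obtain ⟨b, hb, rfl⟩ := ha
    exact ⟨b ::ₘ t, Multiset.map_cons _ _ _, forall_mem_cons hb ht⟩

theorem PS.allRight {A : Fml L} (hA : Fml.all A ∈ Δ)
    (h : PS R c (Fml.shift '' Γ) (insert A (Fml.shift '' Δ))) : PS R c Γ Δ := by
  obtain ⟨G, D, hG, hD, h⟩ := h.exists_right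
  obtain ⟨G', rfl, hG'⟩ := exists_map_eq hG
  obtain ⟨D', rfl, hD'⟩ := exists_map_eq hD
  exact ⟨G', _, hG', forall_mem_cons hA hD', .allRight _ _ _ _ .refl h⟩

/-! ### Literals, disjunctions and one-way clauses as derived rules -/

/-- The sequent becomes provable when the literal `l` is added as a hypothesis. -/
def PSLit (R : Set (Rule L)) (c : Prop) (Γ Δ : Set (Fml L)) (l : Literal L) : Prop :=
  if l.pos = true then PS R c (insert (.atom l.atom) Γ) Δ
  else PS R c Γ (insert (.atom l.atom) Δ)

theorem PSLit.mono {Γ' Δ' : Set (Fml L)} {l : Literal L} (h : PSLit R c Γ Δ l) (hΓ : Γ ⊆ Γ')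
    (hΔ : Δ ⊆ Δ') : PSLit R c Γ' Δ' l := by
  unfold PSLit at h ⊢
  split_ifs at h ⊢
  · exact h.mono (Set.insert_subset_insert hΓ) hΔ
  · exact h.mono hΓ (Set.insert_subset_insert hΔ)

theorem PSLit.toFml {l : Literal L} (h : PSLit R c Γ Δ l) (hl : l.toFml ∈ Γ) : PS R c Γ Δ := by
  unfold PSLit at h
  unfold Literal.toFml at hl
  split_ifs at h hl
  · rwa [Set.insert_eq_of_mem hl] at h
  · exact .negLeft hl h

theorem PS.disj {ls : List (Literal L)} (hls : disj ls ∈ Γ) (h : ∀ l ∈ ls, PSLit R c Γ Δ l) :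
    PS R c Γ Δ := by
  induction ls generalizing Γ with
  | nil => exact .botLeft hls
  | cons l ls ih =>
    cases ls with
    | nil => exact (h l (by simp)).toFml hls
    | cons m ls =>
      refine .orLeft hls ?_ ?_
      · exact ((h l (by simp)).mono (Set.subset_insert _ _) subset_rfl).toFml
          (Set.mem_insert _ _)
      · exact ih (Set.mem_insert _ _) fun l' hl' =>
          (h l' (List.mem_cons_of_mem _ hl')).mono (Set.subset_insert _ _) subset_rfl

theorem disj_subst (ls : List (Literal L)) (σ : Subst L) :
    (PolRes.disj ls).subst σ = PolRes.disj (ls.map fun l => l.subst σ) := by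
  induction ls with
  | nil => rfl
  | cons l ls ih =>
    cases ls with
    | nil => exact (l.toFml_subst σ).symm
    | cons m ls =>
      simp only [PolRes.disj, List.map_cons, Fml.subst, l.toFml_subst] at ih ⊢
      rw [ih]

/-- Each named quantifier on `x` is instantiated by `σ x`, so updating `σ` at `x` changes nothing
and `σ` itself instantiates the matrix. -/
theorem PS.foldr_allVar {xs : List ℕ} {A : Fml L} {σ : Subst L}
    (hA : (xs.foldr Fml.allVar A).subst σ ∈ Γ) (h : PS R c (insert (A.subst σ) Γ) Δ) :
    PS R c Γ Δ := by
  induction xs generalizing Γ with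
  | nil => rwa [Set.insert_eq_of_mem (show A.subst σ ∈ Γ from hA)] at h
  | cons x xs ih =>
    obtain ⟨B, hB, hinst⟩ := Fml.allVar_subst_inst x (xs.foldr Fml.allVar A) σ
    rw [List.foldr_cons, hB] at hA
    refine .allLeft (σ x) hA (ih ?_ (h.mono ?_ subset_rfl))
    · rw [hinst, Function.update_eq_self]
      exact Set.mem_insert _ _
    · exact Set.insert_subset_insert (Set.subset_insert _ _)

end Structural

section OneWay

variable {T : Set (OneWayClause L)} {c : Prop} {Γ Δ : Set (Fml L)}

/-- The derived rule of a one-way clause: if the sequent contradicts the selected literal, it is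
enough to prove it from each of the other literals. -/
theorem PS.oneWay {w : OneWayClause L} (hw : w ∈ T) (σ : Subst L)
    (hneg : w.selected.pos = false → Fml.atom (w.selected.atom.subst σ) ∈ Γ)
    (hpos : w.selected.pos = true → Fml.atom (w.selected.atom.subst σ) ∈ Δ)
    (h : ∀ l ∈ w.rest, PSLit (rewriteSystem T) c Γ Δ (l.subst σ)) :
    PS (rewriteSystem T) c Γ Δ := by
  have key : PS (rewriteSystem T) c (insert (w.body.subst σ) Γ) Δ := by
    refine .foldr_allVar (Set.mem_insert _ _) ?_
    rw [disj_subst]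
    refine .disj (Set.mem_insert _ _) fun l hl => ?_
    obtain ⟨l', hl', rfl⟩ := List.mem_map.1 hl
    exact (h l' hl').mono ((Set.subset_insert _ _).trans (Set.subset_insert _ _)) subset_rfl
  have hstep := Step.rule w.rule (Set.mem_image_of_mem _ hw) σ
  cases hp : w.selected.pos with
  | false =>
    simp only [OneWayClause.rule, hp, Bool.false_eq_true, if_false] at hstep
    exact .redLeft (hneg hp) (.single hstep) key
  | true =>
    simp only [OneWayClause.rule, hp, if_true] at hstep
    refine .redRight (hpos hp) (.single hstep) (.negRight (Set.mem_insert _ _) ?_)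
    exact key.mono subset_rfl (Set.subset_insert _ _)

end OneWay

/-! ### Unification -/

def termSize : L.Term ℕ → ℕ
  | .var _ => 0
  | .func _ ts => 1 + ∑ i, termSize (ts i)

theorem mem_varFinset_subst {t : L.Term ℕ} {σ : Subst L} {y : ℕ} :
    y ∈ (t.subst σ).varFinset ↔ ∃ z ∈ t.varFinset, y ∈ (σ z).varFinset := by
  induction t with
  | var a => simp [Term.subst]
  | func f ts ih =>
    simp only [Term.subst, Term.varFinset, Finset.mem_biUnion, Finset.mem_univ, true_and, ih]
    exact ⟨fun ⟨i, z, h, h'⟩ => ⟨z, ⟨i, h⟩, h'⟩, fun ⟨z, ⟨i, h⟩, h'⟩ => ⟨i, z, h, h'⟩⟩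

theorem termSize_le_subst {t : L.Term ℕ} {σ : Subst L} {x : ℕ} (hx : x ∈ t.varFinset) :
    termSize (σ x) ≤ termSize (t.subst σ) := by
  induction t with
  | var a =>
    obtain rfl : x = a := by simpa using hx
    exact le_rfl
  | func f ts ih =>
    obtain ⟨i, hi⟩ : ∃ i, x ∈ (ts i).varFinset := by simpa using hx
    refine (ih i hi).trans ?_
    simp only [Term.subst, termSize]
    exact (Finset.single_le_sum (f := fun i => termSize ((ts i).subst σ))
      (fun _ _ => Nat.zero_le _) (Finset.mem_univ i)).trans (Nat.le_add_left _ _)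

/-- The occurs check: a proper occurrence of `x` in `t` would make `t.subst σ` strictly larger than
`σ x`. -/
theorem not_mem_varFinset_of_subst_eq {t : L.Term ℕ} {σ : Subst L} {x : ℕ}
    (h : σ x = t.subst σ) (ht : t ≠ Term.var x) : x ∉ t.varFinset := by
  intro hx
  cases t with
  | var a => exact ht (by rw [show x = a by simpa using hx])
  | func f ts =>
    obtain ⟨i, hi⟩ : ∃ i, x ∈ (ts i).varFinset := by simpa using hx
    have h₁ := termSize_le_subst (σ := σ) hi
    have h₂ := Finset.single_le_sum (f := fun i => termSize ((ts i).subst σ))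
      (fun _ _ => Nat.zero_le _) (Finset.mem_univ i)
    rw [h] at h₁
    simp only [Term.subst, termSize] at h₁ h₂
    omega

/-- Two distinct unifiable terms disagree at a position where one of them has a variable. -/
theorem exists_disagreement {s t : L.Term ℕ} {τ : Subst L} (h : s.subst τ = t.subst τ)
    (hne : s ≠ t) : ∃ (x : ℕ) (r : L.Term ℕ), r ≠ Term.var x ∧
      x ∈ s.varFinset ∪ t.varFinset ∧ r.varFinset ⊆ s.varFinset ∪ t.varFinset ∧
      ∀ τ' : Subst L, s.subst τ' = t.subst τ' → τ' x = r.subst τ' := by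
  induction s generalizing t with
  | var x => exact ⟨x, t, hne.symm, by simp, Finset.subset_union_right, fun τ' h => h⟩
  | func f ts ih =>
    cases t with
    | var y => exact ⟨y, _, hne, by simp, Finset.subset_union_left, fun τ' h => h.symm⟩
    | func g us =>
      simp only [Term.subst, Term.func.injEq] at h
      obtain ⟨rfl, hfg, hargs⟩ := h
      obtain rfl := eq_of_heq hfg
      have hargs := congrFun (eq_of_heq hargs)
      obtain ⟨i, hi⟩ : ∃ i, ts i ≠ us i := by
        by_contra! hcon
        exact hne (by rw [funext hcon])
      obtain ⟨x, r, hr, hx, hrs, hmgu⟩ := ih i (hargs i) hi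
      have hsub : (ts i).varFinset ∪ (us i).varFinset ⊆
          (Term.func f ts).varFinset ∪ (Term.func f us).varFinset := by
        refine Finset.union_subset_union ?_ ?_ <;>
        · intro y hy
          simpa using ⟨i, hy⟩
      refine ⟨x, r, hr, hsub hx, hrs.trans hsub, fun τ' h => hmgu τ' ?_⟩
      simp only [Term.subst, Term.func.injEq, heq_eq_eq, true_and] at h
      exact congrFun h i

/-- A unifiable set of equations in finitely many variables has a most general unifier. -/
theorem exists_mgu (V : Finset ℕ) (E : Set (L.Term ℕ × L.Term ℕ))
    (hE : ∀ e ∈ E, e.1.varFinset ⊆ V ∧ e.2.varFinset ⊆ V)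
    (τ : Subst L) (hτ : ∀ e ∈ E, e.1.subst τ = e.2.subst τ) :
    ∃ σ : Subst L, (∀ e ∈ E, e.1.subst σ = e.2.subst σ) ∧
      ∀ τ' : Subst L, (∀ e ∈ E, e.1.subst τ' = e.2.subst τ') →
        ∃ δ : Subst L, ∀ n, τ' n = (σ n).subst δ := by
  induction V using Finset.strongInduction generalizing E with
  | H V ih =>
    by_cases htriv : ∀ e ∈ E, e.1 = e.2
    · exact ⟨Term.var, fun e he => by rw [htriv e he], fun τ' _ => ⟨τ', fun _ => rfl⟩⟩
    push Not at htriv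
    obtain ⟨e, he, hne⟩ := htriv
    obtain ⟨x, r, hr, hx, hrs, hmgu⟩ := exists_disagreement (hτ e he) hne
    have hV := Finset.union_subset (hE e he).1 (hE e he).2
    have hxr := not_mem_varFinset_of_subst_eq (hmgu τ (hτ e he)) hr
    -- `θ` eliminates `x`. Every unifier `τ'` satisfies `τ' x = r.subst τ'`, so it absorbs `θ`;
    -- since `x` does not occur in `r`, one variable fewer remains.
    set θ : Subst L := Function.update Term.var x r with hθ
    have hθτ : ∀ τ' : Subst L, τ' x = r.subst τ' → (fun n => (θ n).subst τ') = τ' := by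
      intro τ' h
      funext n
      by_cases hn : n = x
      · subst hn; simp [hθ, h]
      · simp [hθ, hn, Term.subst]
    have hunif : ∀ τ' : Subst L, (∀ e ∈ E, e.1.subst τ' = e.2.subst τ') →
        ∀ e ∈ (fun e : L.Term ℕ × L.Term ℕ => (e.1.subst θ, e.2.subst θ)) '' E,
          e.1.subst τ' = e.2.subst τ' := by
      rintro τ' h _ ⟨e', he', rfl⟩
      simp only [term_subst_subst, hθτ τ' (hmgu τ' (h e he)), h e' he']
    have hvars : ∀ t : L.Term ℕ, t.varFinset ⊆ V → (t.subst θ).varFinset ⊆ V.erase x := by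
      intro t ht y hy
      obtain ⟨z, hz, hyz⟩ := mem_varFinset_subst.1 hy
      by_cases hzx : z = x
      · subst hzx
        simp only [hθ, Function.update_self] at hyz
        exact Finset.mem_erase.2 ⟨fun h => hxr (h ▸ hyz), hV (hrs hyz)⟩
      · simp only [hθ, Function.update_of_ne hzx, Term.varFinset, Finset.mem_singleton] at hyz
        subst hyz
        exact Finset.mem_erase.2 ⟨hzx, ht hz⟩
    obtain ⟨σ, hσ, hσ'⟩ := ih (V.erase x) (Finset.erase_ssubset (hV hx))
      ((fun e : L.Term ℕ × L.Term ℕ => (e.1.subst θ, e.2.subst θ)) '' E)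
      (by rintro _ ⟨e', he', rfl⟩; exact ⟨hvars _ (hE e' he').1, hvars _ (hE e' he').2⟩)
      (hunif τ hτ)
    refine ⟨fun n => (θ n).subst σ, fun e' he' => ?_, fun τ' hτ' => ?_⟩
    · simpa only [term_subst_subst] using hσ _ (Set.mem_image_of_mem _ he')
    · obtain ⟨δ, hδ⟩ := hσ' τ' (hunif τ' hτ')
      refine ⟨δ, fun n => ?_⟩
      refine (congrFun (hθτ τ' (hmgu τ' (hτ' e he))) n).symm.trans ?_
      simp only [term_subst_subst, ← hδ]

/-- Since some unifier exists, all atoms of `S` share their relation symbol, and unifying them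
amounts to unifying their arguments pairwise. -/
theorem exists_isMGU {S : Set (Atom L)} (V : Finset ℕ) (hV : ∀ P ∈ S, P.vars ⊆ V) {τ : Subst L}
    (hτ : IsUnifier τ S) : ∃ σ, IsMGU σ S := by
  let E : Set (L.Term ℕ × L.Term ℕ) := {e | ∃ (n : ℕ) (r : L.Relations n)
    (ts us : Fin n → L.Term ℕ) (i : Fin n), (⟨n, r, ts⟩ : Atom L) ∈ S ∧ (⟨n, r, us⟩ : Atom L) ∈ S ∧
      e = (ts i, us i)}
  have hE : ∀ σ : Subst L, (∀ e ∈ E, e.1.subst σ = e.2.subst σ) ↔ IsUnifier σ S := by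
    intro σ
    constructor
    · intro h P hP Q hQ
      have hPQ := hτ P hP Q hQ
      obtain ⟨n, r, ts⟩ := P
      obtain ⟨m, q, us⟩ := Q
      simp only [Atom.subst, Atom.mk.injEq] at hPQ
      obtain ⟨rfl, hrq, -⟩ := hPQ
      obtain rfl := eq_of_heq hrq
      simp only [Atom.subst, Atom.mk.injEq, heq_eq_eq, true_and]
      exact funext fun i => h _ ⟨n, r, ts, us, i, hP, hQ, rfl⟩
    · rintro h _ ⟨n, r, ts, us, i, hP, hQ, rfl⟩
      have := h _ hP _ hQ
      simp only [Atom.subst, Atom.mk.injEq, heq_eq_eq, true_and] at this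
      exact congrFun this i
  obtain ⟨σ, hσ, hσ'⟩ := exists_mgu V E (by
    rintro _ ⟨n, r, ts, us, i, hP, hQ, rfl⟩
    refine ⟨fun x hx => hV _ hP ?_, fun x hx => hV _ hQ ?_⟩ <;>
    exact Finset.mem_biUnion.2 ⟨i, Finset.mem_univ i, hx⟩) τ ((hE τ).2 hτ)
  exact ⟨σ, (hE σ).1 hσ, fun τ' h => hσ' τ' ((hE τ').2 h)⟩

/-! ### Renaming apart -/

theorem exists_perm_apart (V W : Finset ℕ) : ∃ ρ : Equiv.Perm ℕ, ∀ x ∈ V, ∀ y ∈ W, ρ x ≠ y := by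
  obtain ⟨m, hm⟩ : ∃ m, ∀ x ∈ V ∪ W, x < m :=
    ⟨(V ∪ W).sup id + 1, fun x hx => Nat.lt_succ_of_le (Finset.le_sup (f := id) hx)⟩
  -- Exchange the blocks `[0, m)` and `[m, 2m)`, where all variables in question are below `m`.
  let f : ℕ → ℕ := fun x => if x < m then x + m else if x < 2 * m then x - m else x
  have hf : Function.Involutive f := by
    intro x
    simp only [f]
    split_ifs <;> omega
  refine ⟨hf.toPerm, fun x hx y hy h => ?_⟩
  have h₁ := hm x (Finset.mem_union_left _ hx)
  have h₂ := hm y (Finset.mem_union_right _ hy)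
  have h₃ : f x = y := h
  simp only [f, if_pos h₁] at h₃
  omega

theorem exists_finset_vars (C : Clause L) : ∃ V : Finset ℕ, ∀ l ∈ C, l.atom.vars ⊆ V := by
  induction C using Multiset.induction with
  | empty => exact ⟨∅, by simp⟩
  | cons l C ih =>
    obtain ⟨V, hV⟩ := ih
    refine ⟨l.atom.vars ∪ V, Multiset.forall_mem_cons.2 ⟨Finset.subset_union_left, ?_⟩⟩
    exact fun l' hl' => (hV l' hl').trans Finset.subset_union_right

theorem mem_vars_rename {P : Atom L} {ρ : ℕ → ℕ} {x : ℕ}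
    (hx : x ∈ (P.subst (renameSubst ρ)).vars) : ∃ y ∈ P.vars, x = ρ y := by
  obtain ⟨i, -, hi⟩ := Finset.mem_biUnion.1 hx
  obtain ⟨y, hy, hxy⟩ := mem_varFinset_subst.1 (show x ∈ ((P.args i).subst _).varFinset from hi)
  exact ⟨y, Finset.mem_biUnion.2 ⟨i, Finset.mem_univ i, hy⟩, by simpa [renameSubst] using hxy⟩

/-- A clause can be renamed apart from another one, so that instances of the two become instances
under the same substitution. -/
theorem exists_apart (C D : Clause L) (τ₁ τ₂ : Subst L) : ∃ (ρ : Equiv.Perm ℕ) (τ : Subst L),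
    Disjoint C.vars (Clause.vars (D.subst (renameSubst ρ))) ∧
    (∀ l ∈ C, l.subst τ = l.subst τ₁) ∧
    ∀ l ∈ D, (l.subst (renameSubst ρ)).subst τ = l.subst τ₂ := by
  classical
  obtain ⟨V, hV⟩ := exists_finset_vars C
  obtain ⟨W, hW⟩ := exists_finset_vars D
  obtain ⟨ρ, hρ⟩ := exists_perm_apart W V
  refine ⟨ρ, fun x => if x ∈ V then τ₁ x else τ₂ (ρ.symm x), ?_, fun l hl => ?_, fun l hl => ?_⟩
  · rw [Set.disjoint_left]
    rintro x ⟨l, hl, hx⟩ ⟨_, hl', hx'⟩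
    obtain ⟨l', hD, rfl⟩ := Multiset.mem_map.1 hl'
    obtain ⟨y, hy, rfl⟩ := mem_vars_rename hx'
    exact hρ y (hW l' hD hy) _ (hV l hl hx) rfl
  · exact Literal.subst_congr fun x hx => if_pos (hV l hl hx)
  · rw [Literal.subst_subst]
    refine Literal.subst_congr fun x hx => ?_
    have : ρ x ∉ V := fun h => hρ x (hW l hl hx) _ h rfl
    simp [renameSubst, Term.subst, this]

/-! ### The ground calculus and the lifting lemma -/

/-- Resolution on instances of clauses, seen as sets of literals, with implicit weakening. -/
inductive GroundDerives (T : Set (OneWayClause L)) (V : Set (Set (Literal L))) :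
    Set (Literal L) → Prop
  | mem (S K : Set (Literal L)) (hK : K ∈ V) (h : K ⊆ S) : GroundDerives T V S
  | res (P : Atom L) (S : Set (Literal L)) (h₁ : GroundDerives T V (insert ⟨true, P⟩ S))
      (h₂ : GroundDerives T V (insert ⟨false, P⟩ S)) : GroundDerives T V S
  | oneWay (c : OneWayClause L) (σ : Subst L) (S : Set (Literal L)) (hc : c ∈ T)
      (h : GroundDerives T V (insert ⟨!c.selected.pos, c.selected.atom.subst σ⟩ S))
      (hS : ∀ l ∈ c.rest, l.subst σ ∈ S) : GroundDerives T V S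

theorem GroundDerives.mono {T : Set (OneWayClause L)} {V : Set (Set (Literal L))}
    {S S' : Set (Literal L)} (h : GroundDerives T V S) (hS : S ⊆ S') : GroundDerives T V S' := by
  induction h generalizing S' with
  | mem S K hK h => exact .mem _ K hK (h.trans hS)
  | res P S _ _ ih₁ ih₂ =>
    exact .res P _ (ih₁ (Set.insert_subset_insert hS)) (ih₂ (Set.insert_subset_insert hS))
  | oneWay c σ S hc _ hl ih =>
    exact .oneWay c σ _ hc (ih (Set.insert_subset_insert hS)) fun l hl' => hS (hl l hl')

/-- The instances of the clauses of `U`. -/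
def instances (U : Set (Clause L)) : Set (Set (Literal L)) :=
  {K | ∃ C ∈ U, ∃ σ : Subst L, K = {l | l ∈ C.subst σ}}

theorem Clause.forall_mem_subst {C : Clause L} {σ : Subst L} {p : Literal L → Prop} :
    (∀ l ∈ C.subst σ, p l) ↔ ∀ l ∈ C, p (l.subst σ) := by
  simp [Clause.subst]

/-- Split a clause according to whether a literal is instantiated to a given one. -/
theorem exists_split {C : Clause L} {τ : Subst L} {a : Literal L} {S : Set (Literal L)}
    (h : ∀ l ∈ C, l.subst τ ∈ insert a S) : ∃ K D : Clause L, C = K + D ∧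
      (∀ l ∈ K, l.subst τ = a) ∧ ∀ l ∈ D, l.subst τ ∈ S := by
  classical
  refine ⟨C.filter fun l => l.subst τ = a, C.filter fun l => ¬ l.subst τ = a,
    (Multiset.filter_add_not _ C).symm, fun l hl => (Multiset.mem_filter.1 hl).2, fun l hl => ?_⟩
  rw [Multiset.mem_filter] at hl
  exact (h l hl.1).resolve_left hl.2

theorem isUnifier_of_forall {S : Set (Atom L)} {τ : Subst L} (P : Atom L)
    (h : ∀ Q ∈ S, Q.subst τ = P) : IsUnifier τ S := fun Q hQ Q' hQ' => by
  rw [h Q hQ, h Q' hQ']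

theorem Literal.subst_factor {σ δ τ : Subst L} (h : ∀ n, τ n = (σ n).subst δ) (l : Literal L) :
    (l.subst σ).subst δ = l.subst τ := by
  rw [Literal.subst_subst]
  congr 1
  exact (funext h).symm

/-- The lifting lemma: a ground derivation is subsumed by a derivation by resolution. -/
theorem GroundDerives.lift {T : Set (OneWayClause L)} {U : Set (Clause L)} {S : Set (Literal L)}
    (h : GroundDerives T (instances U) S) :
    ∃ (C : Clause L) (τ : Subst L), Derives T U C ∧ ∀ l ∈ C, l.subst τ ∈ S := by
  induction h with
  | mem S K hK h =>
    obtain ⟨C, hC, σ, rfl⟩ := hK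
    exact ⟨C, σ, .input C hC, Clause.forall_mem_subst.1 fun l hl => h hl⟩
  | res P S _ _ ih₁ ih₂ =>
    obtain ⟨C₁, τ₁, hC₁, h₁⟩ := ih₁
    obtain ⟨C₂, τ₂, hC₂, h₂⟩ := ih₂
    obtain ⟨ρ, τ, hapart, hτ₁, hτ₂⟩ := exists_apart C₁ C₂ τ₁ τ₂
    have h₁' : ∀ l ∈ C₁, l.subst τ ∈ insert ⟨true, P⟩ S := fun l hl => by
      rw [hτ₁ l hl]
      exact h₁ l hl
    have h₂' : ∀ l ∈ C₂.subst (renameSubst ρ), l.subst τ ∈ insert ⟨false, P⟩ S :=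
      Clause.forall_mem_subst.2 fun l hl => by
        rw [hτ₂ l hl]
        exact h₂ l hl
    replace hC₂ := hC₂.rename _ ρ
    generalize Clause.subst C₂ (renameSubst ρ) = C₂' at *
    obtain ⟨K, C, rfl, hK, hC⟩ := exists_split h₁'
    obtain ⟨N, D, rfl, hN, hD⟩ := exists_split h₂'
    -- If no literal of a premise is instantiated to the resolved one, that premise already subsumes
    -- the conclusion.
    by_cases hK0 : K = 0
    · subst hK0
      exact ⟨0 + C, τ, hC₁, by simpa using hC⟩
    by_cases hN0 : N = 0
    · subst hN0
      exact ⟨0 + D, τ, hC₂, by simpa using hD⟩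
    have hunif : IsUnifier τ (Clause.atoms (K + N)) := by
      refine isUnifier_of_forall P ?_
      rintro _ ⟨l, hl, rfl⟩
      rcases Multiset.mem_add.1 hl with hl | hl
      · exact congrArg Literal.atom (hK l hl)
      · exact congrArg Literal.atom (hN l hl)
    obtain ⟨V, hV⟩ := exists_finset_vars (K + N)
    obtain ⟨σ, hσ⟩ := exists_isMGU V (by rintro _ ⟨l, hl, rfl⟩; exact hV l hl) hunif
    obtain ⟨δ, hδ⟩ := hσ.2 τ hunif
    refine ⟨_, δ, .resolve K C N D σ hK0 hN0 (fun l hl => congrArg Literal.pos (hK l hl))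
      (fun l hl => congrArg Literal.pos (hN l hl)) hapart hσ hC₁ hC₂,
      Clause.forall_mem_subst.2 fun l hl => ?_⟩
    rw [Literal.subst_factor hδ]
    exact (Multiset.mem_add.1 hl).elim (hC l) (hD l)
  | oneWay c σ S hc _ hS ih =>
    obtain ⟨C, τ₁, hC, h⟩ := ih
    obtain ⟨ρ, τ, hapart, hτ₁, hτ₂⟩ := exists_apart C c.toClause τ₁ σ
    have h' : ∀ l ∈ C, l.subst τ ∈ insert ⟨!c.selected.pos, c.selected.atom.subst σ⟩ S :=
      fun l hl => by
        rw [hτ₁ l hl]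
        exact h l hl
    obtain ⟨K, D, rfl, hK, hD⟩ := exists_split h'
    by_cases hK0 : K = 0
    · subst hK0
      exact ⟨0 + D, τ, hC, by simpa using hD⟩
    have hsel : (c.selected.subst (renameSubst ρ)).subst τ = c.selected.subst σ :=
      hτ₂ _ (Multiset.mem_cons_self _ _)
    have hunif : IsUnifier τ
        (insert (c.subst (renameSubst ρ)).selected.atom (Clause.atoms K)) := by
      refine isUnifier_of_forall (c.selected.atom.subst σ) ?_
      rintro _ (rfl | ⟨l, hl, rfl⟩)
      · exact congrArg Literal.atom hsel
      · exact congrArg Literal.atom (hK l hl)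
    obtain ⟨V, hV⟩ := exists_finset_vars ((c.subst (renameSubst ρ)).selected ::ₘ K)
    obtain ⟨μ, hμ⟩ := exists_isMGU V (by
      rintro _ (rfl | ⟨l, hl, rfl⟩)
      · exact hV _ (Multiset.mem_cons_self _ _)
      · exact hV _ (Multiset.mem_cons_of_mem hl)) hunif
    obtain ⟨δ, hδ⟩ := hμ.2 τ hunif
    refine ⟨_, δ, .resolveOneWay c ρ K D μ hc hK0 (fun l hl => congrArg Literal.pos (hK l hl))
      ?_ hμ hC, Clause.forall_mem_subst.2 fun l hl => ?_⟩
    · have : (c.subst (renameSubst ρ)).toClause = Clause.subst c.toClause (renameSubst ρ) := by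
        simp [OneWayClause.toClause, OneWayClause.subst, Clause.subst]
      rw [this]
      exact hapart.symm
    · rw [Literal.subst_factor hδ]
      rcases Multiset.mem_add.1 hl with hl | hl
      · obtain ⟨l', hl', rfl⟩ := List.mem_map.1 (Multiset.mem_coe.1 hl)
        rw [hτ₂ l' (Multiset.mem_cons_of_mem hl')]
        exact hS l' hl'
      · exact hD l hl

/-! ### Ground clauses of a proposition -/

/-- The ground clauses that express `A` (if `p = false`) or `¬ A` (if `p = true`), in a given
environment. A universal quantifier at positive polarity is not expressible: it gets the empty
clause. -/
def groundClauses : Bool → Fml L → Subst L → Set (Set (Literal L))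
  | false, .bot, _ => {∅}
  | true, .bot, _ => ∅
  | p, .atom P, σ => {{⟨!p, P.subst σ⟩}}
  | p, .neg A, σ => groundClauses (!p) A σ
  | false, .or A B, σ =>
    {K | ∃ K₁ ∈ groundClauses false A σ, ∃ K₂ ∈ groundClauses false B σ, K = K₁ ∪ K₂}
  | true, .or A B, σ => groundClauses true A σ ∪ groundClauses true B σ
  | false, .all A, σ => {K | ∃ t, K ∈ groundClauses false A (scons t σ)}
  | true, .all _, _ => {∅}

theorem groundClauses_neg (p : Bool) (A : Fml L) (σ : Subst L) :
    groundClauses p A.neg σ = groundClauses (!p) A σ := by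
  cases p <;> rfl

theorem groundClauses_subst (p : Bool) (A : Fml L) (θ σ : Subst L) :
    groundClauses p (A.subst θ) σ = groundClauses p A fun n => (θ n).subst σ := by
  induction A generalizing p θ σ with
  | bot => cases p <;> rfl
  | atom P => cases p <;> simp [Fml.subst, groundClauses, Atom.subst_subst]
  | neg A ih => cases p <;> simp [Fml.subst, groundClauses, ih]
  | or A B ihA ihB => cases p <;> simp [Fml.subst, groundClauses, ihA, ihB]
  | all A ih => cases p <;> simp [Fml.subst, groundClauses, ih, up_subst_scons]

theorem groundClauses_inst (p : Bool) (A : Fml L) (t : L.Term ℕ) :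
    groundClauses p (A.inst t) Term.var = groundClauses p A (scons t Term.var) := by
  rw [Fml.inst_eq, groundClauses_subst]
  simp only [term_subst_var]

theorem groundClauses_toFml (l : Literal L) (σ : Subst L) :
    groundClauses false l.toFml σ = {{l.subst σ}} := by
  obtain ⟨_ | _, P⟩ := l <;> rfl

theorem mem_of_mem_groundClauses_disj {ls : List (Literal L)} {σ : Subst L} {K : Set (Literal L)}
    (hK : K ∈ groundClauses false (disj ls) σ) : ∀ l ∈ ls, l.subst σ ∈ K := by
  induction ls generalizing K with
  | nil => simp
  | cons l ls ih =>
    cases ls with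
    | nil =>
      simp only [disj, groundClauses_toFml, Set.mem_singleton_iff] at hK
      simp [hK]
    | cons m ls =>
      obtain ⟨K₁, h₁, K₂, h₂, rfl⟩ := hK
      rw [groundClauses_toFml, Set.mem_singleton_iff] at h₁
      subst h₁
      intro l' hl'
      rcases List.mem_cons.1 hl' with rfl | hl'
      · exact .inl rfl
      · exact .inr (ih h₂ l' hl')

theorem exists_of_mem_groundClauses_foldr {xs : List ℕ} {A : Fml L} {σ : Subst L}
    {K : Set (Literal L)} (hK : K ∈ groundClauses false (xs.foldr Fml.allVar A) σ) :
    ∃ σ' : Subst L, (∀ x ∉ xs, σ' x = σ x) ∧ K ∈ groundClauses false A σ' := by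
  induction xs generalizing σ with
  | nil => exact ⟨σ, fun _ _ => rfl, hK⟩
  | cons x xs ih =>
    obtain ⟨t, ht⟩ := hK
    rw [groundClauses_subst] at ht
    obtain ⟨σ', hσ', hK⟩ := ih ht
    refine ⟨σ', fun y hy => ?_, hK⟩
    rw [List.mem_cons, not_or] at hy
    simp [hσ' y hy.2, hy.1, Term.subst, scons]

/-! ### Cut-free proofs and the ground calculus -/

section CutFree

variable {T : Set (OneWayClause L)} {V : Set (Set (Literal L))}

/-- At an atom the step is one resolution with an instance of the one-way clause. The context `S`
carries the other disjunct through a disjunction. Under a positive quantifier nothing is to be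
shown, as its ground clauses ignore the body. -/
theorem groundDerives_step {p : Bool} {A B : Fml L} (h : Step (rewriteSystem T) p A B)
    (σ : Subst L) (S : Set (Literal L))
    (hA : ∀ K ∈ groundClauses p A σ, GroundDerives T V (K ∪ S)) :
    ∀ K ∈ groundClauses p B σ, GroundDerives T V (K ∪ S) := by
  induction h generalizing σ S with
  | rule r hr θ =>
    obtain ⟨c, hc, rfl⟩ := hr
    intro K hK
    rw [groundClauses_subst] at hK
    replace hK : K ∈ groundClauses false c.body fun n => (θ n).subst σ := by
      cases hp : c.selected.pos <;> simpa [OneWayClause.rule, hp, groundClauses] using hK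
    obtain ⟨σ', hσ', hK⟩ := exists_of_mem_groundClauses_foldr hK
    have hrest := mem_of_mem_groundClauses_disj hK
    refine .oneWay c σ' _ hc ?_ fun l hl => .inl (hrest l hl)
    have hsel : c.selected.atom.subst σ' = (c.selected.atom.subst θ).subst σ := by
      rw [Atom.subst_subst]
      exact Atom.subst_congr fun x hx => hσ' x fun hx' => ((c.mem_extraVars x).1 hx').2 hx
    rw [hsel]
    refine (hA {⟨!c.selected.pos, (c.selected.atom.subst θ).subst σ⟩} ?_).mono ?_
    · simp only [OneWayClause.rule, groundClauses, Set.mem_singleton_iff]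
    · rw [Set.singleton_union]
      exact Set.insert_subset_insert Set.subset_union_right
  | neg p A A' _ ih =>
    rw [groundClauses_neg] at hA ⊢
    exact ih σ S hA
  | orLeft p A A' B _ ih =>
    cases p with
    | true =>
      rintro K (hK | hK)
      · exact ih σ S (fun K hK => hA K (.inl hK)) K hK
      · exact hA K (.inr hK)
    | false =>
      rintro _ ⟨K₁, h₁, K₂, h₂, rfl⟩
      rw [Set.union_assoc]
      refine ih σ (K₂ ∪ S) (fun K hK => ?_) K₁ h₁
      rw [← Set.union_assoc]
      exact hA _ ⟨K, hK, K₂, h₂, rfl⟩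
  | orRight p A B B' _ ih =>
    cases p with
    | true =>
      rintro K (hK | hK)
      · exact hA K (.inl hK)
      · exact ih σ S (fun K hK => hA K (.inr hK)) K hK
    | false =>
      rintro _ ⟨K₁, h₁, K₂, h₂, rfl⟩
      rw [Set.union_comm K₁, Set.union_assoc]
      refine ih σ (K₁ ∪ S) (fun K hK => ?_) K₂ h₂
      rw [← Set.union_assoc, Set.union_comm K]
      exact hA _ ⟨K₁, h₁, K, hK, rfl⟩
  | all p A A' _ ih =>
    cases p with
    | true => exact hA
    | false =>
      rintro K ⟨t, hK⟩
      exact ih (scons t σ) S (fun K hK => hA K ⟨t, hK⟩) K hK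

/-- All the ground clauses of `A`, at polarity `p`, are derivable. -/
def GroundAccepts (T : Set (OneWayClause L)) (V : Set (Set (Literal L))) (p : Bool)
    (A : Fml L) : Prop :=
  ∀ K ∈ groundClauses p A Term.var, GroundDerives T V K

theorem GroundAccepts.red {p : Bool} {A B : Fml L}
    (h : Relation.ReflTransGen (Step (rewriteSystem T) p) A B) (hA : GroundAccepts T V p A) :
    GroundAccepts T V p B := by
  induction h with
  | refl => exact hA
  | tail _ h ih =>
    intro K hK
    have := groundDerives_step h Term.var ∅ (fun K hK => by simpa using ih K hK) K hK
    rwa [Set.union_empty] at this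

/-- A derivation can carry the extra literals `S₀` along: if each input is available with `S₀`
added, so is the conclusion. -/
theorem GroundDerives.subst_inputs {V' : Set (Set (Literal L))} {S S₀ : Set (Literal L)}
    (h : GroundDerives T V' S) (hV : ∀ K ∈ V', GroundDerives T V (K ∪ S₀)) :
    GroundDerives T V (S ∪ S₀) := by
  induction h with
  | mem S K hK h => exact (hV K hK).mono (Set.union_subset_union_left _ h)
  | res P S _ _ ih₁ ih₂ =>
    rw [Set.insert_union] at ih₁ ih₂
    exact .res P _ ih₁ ih₂
  | oneWay c σ S hc _ hS ih =>
    rw [Set.insert_union] at ih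
    exact .oneWay c σ _ hc ih fun l hl => .inl (hS l hl)

theorem GroundDerives.of_subset {V' : Set (Set (Literal L))} {S : Set (Literal L)}
    (h : GroundDerives T V S) (hV : V ⊆ V') : GroundDerives T V' S := by
  simpa using h.subst_inputs (S₀ := ∅) fun K hK => .mem _ K (hV hK) (by simp)

/-- Each rule passes derivability of ground clauses from its conclusion to its premises; at an axiom
a resolution on the common atom closes the argument. The inputs `V` vary because a disjunction on
the left needs the clauses of one disjunct as temporary inputs. -/
theorem Sequent.groundDerives {c : Prop} (hc : ¬ c) {Γ Δ : Multiset (Fml L)}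
    (h : Sequent (rewriteSystem T) c Γ Δ) (V : Set (Set (Literal L)))
    (hΓ : ∀ A ∈ Γ, GroundAccepts T V false A) (hΔ : ∀ A ∈ Δ, GroundAccepts T V true A) :
    GroundDerives T V ∅ := by
  induction h generalizing V with
  | ax A B P hA hB =>
    have h₁ := (hΓ A (by simp)).red hA _ rfl
    have h₂ := (hΔ B (by simp)).red hB _ rfl
    rw [Atom.subst_var] at h₁ h₂
    exact .res P ∅ (by simpa using h₁) (by simpa using h₂)
  | cut h => exact (hc h).elim
  | contrLeft Γ Δ A B C hB hC _ ih =>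
    rw [Multiset.forall_mem_cons] at hΓ
    refine ih V ?_ hΔ
    rw [Multiset.forall_mem_cons, Multiset.forall_mem_cons]
    exact ⟨hΓ.1.red hB, hΓ.1.red hC, hΓ.2⟩
  | contrRight Γ Δ A B C hB hC _ ih =>
    rw [Multiset.forall_mem_cons] at hΔ
    refine ih V hΓ ?_
    rw [Multiset.forall_mem_cons, Multiset.forall_mem_cons]
    exact ⟨hΔ.1.red hB, hΔ.1.red hC, hΔ.2⟩
  | weakLeft Γ Δ A _ ih => exact ih V (Multiset.forall_mem_cons.1 hΓ).2 hΔ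
  | weakRight Γ Δ A _ ih => exact ih V hΓ (Multiset.forall_mem_cons.1 hΔ).2
  | botLeft Γ Δ A hA => exact (hΓ A (by simp)).red hA _ rfl
  | negLeft Γ Δ A B hA _ ih =>
    rw [Multiset.forall_mem_cons] at hΓ
    exact ih V hΓ.2 (Multiset.forall_mem_cons.2 ⟨GroundAccepts.red (B := .neg B) hA hΓ.1, hΔ⟩)
  | negRight Γ Δ A B hA _ ih =>
    rw [Multiset.forall_mem_cons] at hΔ
    exact ih V (Multiset.forall_mem_cons.2 ⟨GroundAccepts.red (B := .neg B) hA hΔ.1, hΓ⟩)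
      hΔ.2
  | orLeft Γ Δ A B C hA _ _ ih₁ ih₂ =>
    rw [Multiset.forall_mem_cons] at hΓ
    have hBC := hΓ.1.red hA
    refine ih₂ V (Multiset.forall_mem_cons.2 ⟨fun K₂ hK₂ => ?_, hΓ.2⟩) hΔ
    have h₁ := ih₁ (V ∪ groundClauses false B Term.var)
      (Multiset.forall_mem_cons.2 ⟨fun K hK => .mem _ K (.inr hK) subset_rfl,
        fun D hD K hK => (hΓ.2 D hD K hK).of_subset Set.subset_union_left⟩)
      fun D hD K hK => (hΔ D hD K hK).of_subset Set.subset_union_left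
    -- The refutation from the clauses of `B` becomes a derivation of `K₂` once `K₂` is added to its
    -- inputs, since `K ∪ K₂` is a ground clause of `B ∨ C`.
    rw [← Set.empty_union K₂]
    refine h₁.subst_inputs ?_
    rintro K (hK | hK)
    · exact .mem _ K hK Set.subset_union_left
    · exact hBC _ ⟨K, hK, K₂, hK₂, rfl⟩
  | orRight Γ Δ A B C hA _ ih =>
    rw [Multiset.forall_mem_cons] at hΔ
    have hBC := hΔ.1.red hA
    refine ih V hΓ ?_
    rw [Multiset.forall_mem_cons, Multiset.forall_mem_cons]
    exact ⟨fun K hK => hBC K (.inl hK), fun K hK => hBC K (.inr hK), hΔ.2⟩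
  | allLeft Γ Δ A B C t hA hC _ ih =>
    rw [Multiset.forall_mem_cons] at hΓ
    have hB := hΓ.1.red hA
    refine ih V (Multiset.forall_mem_cons.2 ⟨?_, hΓ.2⟩) hΔ
    refine GroundAccepts.red hC fun K hK => hB K ?_
    rw [groundClauses_inst] at hK
    exact ⟨t, hK⟩
  -- The only ground clause of a positive quantifier is empty, so the hypothesis on `A` is already
  -- the goal.
  | allRight Γ Δ A B hA _ _ => exact (hΔ A (by simp)).red hA _ rfl

end CutFree

/-! ### Propositional compactness and term models -/

/-- Propositional compactness: an unsatisfiable family of finite disjunctions of signed atoms has a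
finite unsatisfiable subfamily. -/
theorem exists_finset_unsat {X ι : Type*} (F : ι → Multiset (Bool × X))
    (h : ¬ ∃ v : X → Bool, ∀ i, ∃ l ∈ F i, v l.2 = l.1) :
    ∃ t : Finset ι, ¬ ∃ v : X → Bool, ∀ i ∈ t, ∃ l ∈ F i, v l.2 = l.1 := by
  obtain ⟨t, ht⟩ := (isCompact_univ (X := X → Bool)).elim_finite_subfamily_closed
    (fun i => {v : X → Bool | ∃ l ∈ F i, v l.2 = l.1})
    (fun i => by
      have : {v : X → Bool | ∃ l ∈ F i, v l.2 = l.1} =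
          ⋃ l ∈ {l | l ∈ F i}, {v : X → Bool | v l.2 = l.1} := by
        ext v; simp
      rw [this]
      refine Set.Finite.isClosed_biUnion (Multiset.finite_toSet _) fun l _ => ?_
      exact isClosed_eq (continuous_apply l.2) continuous_const)
    (by
      rw [Set.univ_inter, Set.eq_empty_iff_forall_notMem]
      exact fun v hv => h ⟨v, fun i => Set.mem_iInter.1 hv i⟩)
  refine ⟨t, fun ⟨v, hv⟩ => ?_⟩
  have : v ∈ (Set.univ ∩ ⋂ i ∈ t, {v : X → Bool | ∃ l ∈ F i, v l.2 = l.1} : Set (X → Bool)) :=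
    ⟨trivial, Set.mem_iInter₂.2 hv⟩
  rw [ht] at this
  exact this

/-- The term structure over `α` in which the relations are interpreted by `v`. -/
abbrev termStructure {α : Type*} (v : ∀ n, L.Relations n → (Fin n → L.Term α) → Prop) :
    L.Structure (L.Term α) where
  funMap f ts := Term.func f ts
  RelMap r ts := v _ r ts

theorem termStructure_realize {α : Type*}
    (v : ∀ n, L.Relations n → (Fin n → L.Term α) → Prop) (t : L.Term ℕ) (s : ℕ → L.Term α) :
    letI := termStructure v
    t.realize s = t.subst s := by
  induction t with
  | var n => rfl
  | func f ts ih =>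
    simp only [Term.realize, Term.subst]
    exact congrArg (Term.func f) (funext ih)

/-! ### Cut admissibility implies completeness -/

section Completeness

variable {T : Set (OneWayClause L)} {U : Set (Clause L)}

/-- The clauses of `U`, as quantifier-free propositions, in all instances. -/
def instanceFmls (U : Set (Clause L)) : Set (Fml L) :=
  {A | ∃ C ∈ U, ∃ σ : Subst L, A = (disj C.toList).subst σ}

/-- A semantic tree: `As` lists atoms still to be decided, and a cut on an atom puts it on the left
(true) in one branch and on the right (false) in the other. At a leaf, `Γ` and `Δ` falsify every
literal of some instance. -/
theorem PS.of_finite_unsat (t : List (Clause L))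
    (ht : ∀ K ∈ t, ∃ C ∈ OneWayClause.toClause '' T ∪ U, ∃ σ : Subst L, K = C.subst σ)
    (As : List (Atom L)) (Γ Δ : Set (Fml L)) (hU : instanceFmls U ⊆ Γ)
    (hAs : ∀ K ∈ t, ∀ l ∈ K, l.atom ∈ As ∨ .atom l.atom ∈ Γ ∨ .atom l.atom ∈ Δ)
    (hun : ∀ v : Atom L → Bool, (∀ P, .atom P ∈ Γ → v P = true) →
      (∀ P, .atom P ∈ Δ → v P = false) → ∃ K ∈ t, ∀ l ∈ K, v l.atom ≠ l.pos) :
    PS (rewriteSystem T) True Γ Δ := by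
  classical
  induction As generalizing Γ Δ with
  | nil =>
    by_cases hax : ∃ P : Atom L, .atom P ∈ Γ ∧ .atom P ∈ Δ
    · obtain ⟨P, h₁, h₂⟩ := hax
      exact .ax h₁ h₂
    push Not at hax
    -- The valuation true exactly on the atoms of `Γ` respects `Δ`, since no atom lies on both
    -- sides.
    obtain ⟨K, hK, hv⟩ := hun (fun P => decide (.atom P ∈ Γ)) (fun P h => by simpa using h)
      fun P h => by simpa using fun h' => hax P h' h
    have hpos : ∀ l ∈ K, l.pos = true → .atom l.atom ∈ Δ := fun l hl hp => by
      have h₁ := hv l hl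
      simp only [hp, ne_eq, decide_eq_true_eq] at h₁
      simpa [h₁] using hAs K hK l hl
    have hneg : ∀ l ∈ K, l.pos = false → .atom l.atom ∈ Γ := fun l hl hp => by
      simpa [hp] using hv l hl
    have hlit : ∀ l ∈ K, PSLit (rewriteSystem T) True Γ Δ l := fun l hl => by
      unfold PSLit
      split_ifs with hp
      · exact .ax (Set.mem_insert _ _) (hpos l hl hp)
      · exact .ax (hneg l hl (by simpa using hp)) (Set.mem_insert _ _)
    obtain ⟨C, ⟨c, hc, rfl⟩ | hC, σ, rfl⟩ := ht K hK
    · have hsel : c.selected.subst σ ∈ Clause.subst c.toClause σ :=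
        Multiset.mem_map_of_mem _ (Multiset.mem_cons_self _ _)
      exact .oneWay hc σ (hneg _ hsel) (hpos _ hsel) fun l hl =>
        hlit _ (Multiset.mem_map_of_mem _ (Multiset.mem_cons_of_mem hl))
    · refine .disj (ls := C.toList.map fun l => l.subst σ) (hU ⟨C, hC, σ, ?_⟩) fun l hl => ?_
      · rw [disj_subst]
      · obtain ⟨l', hl', rfl⟩ := List.mem_map.1 hl
        exact hlit _ (Multiset.mem_map_of_mem _ (Multiset.mem_toList.1 hl'))
  | cons P As ih =>
    refine .cut trivial (A := .atom P) (ih _ _ (hU.trans (Set.subset_insert _ _)) ?_ ?_)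
      (ih _ _ hU ?_ ?_)
    · intro K hK l hl
      rcases hAs K hK l hl with h | h | h
      · rcases List.mem_cons.1 h with h | h
        · exact .inr (.inl (.inl (congrArg _ h)))
        · exact .inl h
      · exact .inr (.inl (.inr h))
      · exact .inr (.inr h)
    · exact fun v h₁ h₂ => hun v (fun Q hQ => h₁ Q (.inr hQ)) h₂
    · intro K hK l hl
      rcases hAs K hK l hl with h | h | h
      · rcases List.mem_cons.1 h with h | h
        · exact .inr (.inr (.inl (congrArg _ h)))
        · exact .inl h
      · exact .inr (.inl h)
      · exact .inr (.inr (.inr h))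
    · exact fun v h₁ h₂ => hun v h₁ (fun Q hQ => h₂ Q (.inr hQ))

/-- Herbrand's theorem: an unsatisfiable set of clauses has a finite unsatisfiable set of
instances. -/
theorem Unsatisfiable.exists_list {S : Set (Clause L)} (h : Unsatisfiable S) :
    ∃ t : List (Clause L), (∀ K ∈ t, ∃ C ∈ S, ∃ σ : Subst L, K = C.subst σ) ∧
      ∀ v : Atom L → Bool, ∃ K ∈ t, ∀ l ∈ K, v l.atom ≠ l.pos := by
  obtain ⟨t, ht⟩ := exists_finset_unsat
    (ι := {K : Clause L // ∃ C ∈ S, ∃ σ : Subst L, K = C.subst σ})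
    (fun K => K.1.map fun l => (l.pos, l.atom)) (by
      rintro ⟨v, hv⟩
      let := termStructure (L := L) (α := ℕ) fun n r ts => v ⟨n, r, ts⟩ = true
      have : Nonempty (L.Term ℕ) := ⟨Term.var 0⟩
      refine h (L.Term ℕ) fun C hC s => ?_
      obtain ⟨_, hl, hvl⟩ := hv ⟨_, C, hC, s, rfl⟩
      obtain ⟨_, hl', rfl⟩ := Multiset.mem_map.1 hl
      obtain ⟨l, hC', rfl⟩ := Multiset.mem_map.1 hl'
      refine ⟨l, hC', ?_⟩
      have : l.atom.Holds s ↔ v (l.atom.subst s) = true := by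
        simp only [Atom.Holds, termStructure_realize]
        rfl
      simp only [Literal.subst] at hvl
      cases hp : l.pos <;> simp [Literal.Holds, this, hp, hvl])
  refine ⟨t.toList.map Subtype.val, fun K hK => ?_, fun v => ?_⟩
  · obtain ⟨K, -, rfl⟩ := List.mem_map.1 hK
    exact K.2
  · by_contra! hcon
    refine ht ⟨v, fun K hK => ?_⟩
    obtain ⟨l, hl, h⟩ := hcon K.1 (List.mem_map_of_mem (Finset.mem_toList.2 hK))
    exact ⟨_, Multiset.mem_map_of_mem _ hl, h⟩

theorem groundAccepts_instanceFmls {A : Fml L} (hA : A ∈ instanceFmls U) :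
    GroundAccepts T (instances U) false A := by
  obtain ⟨C, hC, σ, rfl⟩ := hA
  intro K hK
  rw [disj_subst] at hK
  refine .mem K _ ⟨C, hC, σ, rfl⟩ ?_
  refine Clause.forall_mem_subst.2 fun l hl => ?_
  have := mem_of_mem_groundClauses_disj hK (l.subst σ)
    (List.mem_map_of_mem (Multiset.mem_toList.2 hl))
  rwa [Literal.subst_var] at this

theorem resolutionComplete_of_admitsCut (h : AdmitsCut (rewriteSystem T)) :
    ResolutionComplete T := by
  intro U hU
  obtain ⟨t, ht, hun⟩ := hU.exists_list
  obtain ⟨Γ, Δ, hΓ, hΔ, hseq⟩ := PS.of_finite_unsat t ht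
    (t.flatMap fun K => K.toList.map Literal.atom) (instanceFmls U) ∅ subset_rfl
    (fun K hK l hl => .inl (List.mem_flatMap.2
      ⟨K, hK, List.mem_map_of_mem (Multiset.mem_toList.2 hl)⟩))
    fun v _ _ => hun v
  have hground := (h Γ Δ hseq).groundDerives id (instances U)
    (fun A hA => groundAccepts_instanceFmls (hΓ A hA)) fun A hA => (hΔ A hA).elim
  obtain ⟨C, τ, hC, hemp⟩ := hground.lift
  rwa [Multiset.eq_zero_of_forall_notMem (s := C) fun l hl => hemp l hl] at hC

end Completeness

/-! ### Parameters -/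

/-- Parameters: names for the free variables, and at each stage `n` a witness for every universally
quantified proposition in every environment. -/
inductive Param (L : FirstOrder.Language.{u, v}) : Type (max u v)
  | base (k : ℕ) : Param L
  | wit (n : ℕ) (A : Fml L) (σ : ℕ → L.Term (Param L)) : Param L

/-- A witness introduced at stage `n` has level `n + 1`, hence is absent from all environments of
that stage. -/
def Param.level : Param L → ℕ
  | .base _ => 0
  | .wit n _ _ => n + 1

/-- All the variables of the term satisfy `p`. -/
def TermAll {α : Type*} (p : α → Prop) : L.Term α → Prop
  | .var a => p a
  | .func _ ts => ∀ i, TermAll p (ts i)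

theorem TermAll.mono {α : Type*} {p q : α → Prop} {t : L.Term α} (h : TermAll p t)
    (hpq : ∀ a, p a → q a) : TermAll q t := by
  induction t with
  | var a => exact hpq a h
  | func f ts ih => exact fun i => ih i (h i)

theorem TermAll.subst_congr {α β : Type*} {p : α → Prop} {t : L.Term α} (h : TermAll p t)
    {σ τ : α → L.Term β} (hst : ∀ a, p a → σ a = τ a) : t.subst σ = t.subst τ := by
  induction t with
  | var a => exact hst a h
  | func f ts ih => exact congrArg (Term.func f) (funext fun i => ih i (h i))

theorem exists_termAll_level (t : L.Term (Param L)) : ∃ n, TermAll (fun w => w.level ≤ n) t := by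
  induction t with
  | var a => exact ⟨a.level, le_rfl⟩
  | func f ts ih =>
    choose n hn using ih
    exact ⟨Finset.univ.sup n, fun i => (hn i).mono fun w hw =>
      hw.trans (Finset.le_sup (Finset.mem_univ i))⟩

theorem exists_finite_termAll {α : Type*} (t : L.Term α) :
    ∃ W : Set α, W.Finite ∧ TermAll (· ∈ W) t := by
  induction t with
  | var a => exact ⟨{a}, Set.finite_singleton a, rfl⟩
  | func f ts ih =>
    choose W hW hW' using ih
    exact ⟨⋃ i, W i, Set.finite_iUnion hW, fun i => (hW' i).mono fun w hw =>
      Set.mem_iUnion.2 ⟨i, hw⟩⟩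

/-- Environments whose parameters have level at most `n`. -/
def EnvLevel (n : ℕ) (σ : ℕ → L.Term (Param L)) : Prop :=
  ∀ i, TermAll (fun w => w.level ≤ n) (σ i)

theorem EnvLevel.mono {m n : ℕ} {σ : ℕ → L.Term (Param L)} (h : EnvLevel m σ) (hmn : m ≤ n) :
    EnvLevel n σ :=
  fun i => (h i).mono fun _ hw => hw.trans hmn

theorem EnvLevel.scons {n : ℕ} {σ : ℕ → L.Term (Param L)} (h : EnvLevel n σ)
    {t : L.Term (Param L)} (ht : TermAll (fun w => w.level ≤ n) t) : EnvLevel n (scons t σ) := by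
  intro i
  cases i with
  | zero => exact ht
  | succ i => exact h i

/-- Atoms whose arguments are terms over `α`. -/
structure GroundAtom (L : FirstOrder.Language.{u, v}) (α : Type*) where
  arity : ℕ
  rel : L.Relations arity
  args : Fin arity → L.Term α

def Atom.ground {α : Type*} (P : Atom L) (σ : ℕ → L.Term α) : GroundAtom L α :=
  ⟨P.arity, P.rel, fun i => (P.args i).subst σ⟩

def GroundAtom.toAtom {α : Type*} (a : GroundAtom L α) (g : α → L.Term ℕ) : Atom L :=
  ⟨a.arity, a.rel, fun i => (a.args i).subst g⟩

theorem Atom.toAtom_ground {α : Type*} (P : Atom L) (σ : ℕ → L.Term α) (g : α → L.Term ℕ) :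
    (P.ground σ).toAtom g = P.subst fun n => (σ n).subst g := by
  simp [Atom.ground, GroundAtom.toAtom, Atom.subst, term_subst_subst]

theorem Atom.ground_congr {α : Type*} {P : Atom L} {σ τ : ℕ → L.Term α}
    (h : ∀ x ∈ P.vars, σ x = τ x) : P.ground σ = P.ground τ := by
  simp only [Atom.ground, GroundAtom.mk.injEq, heq_eq_eq, true_and]
  exact funext fun i => term_subst_congr fun x hx =>
    h x (Finset.mem_biUnion.2 ⟨i, Finset.mem_univ i, hx⟩)

/-! ### Consistent sets of signed propositions -/

/-- A proposition in an environment, on the left (`pol = false`) or on the right (`pol = true`)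
of a sequent. -/
structure Item (L : FirstOrder.Language.{u, v}) where
  pol : Bool
  fml : Fml L
  env : ℕ → L.Term (Param L)

/-- The proposition of an item, when the parameters are replaced by terms. -/
def Item.inst (i : Item L) (g : Param L → L.Term ℕ) : Fml L :=
  i.fml.subst fun n => (i.env n).subst g

/-- One side of the sequent given by a set of items. -/
def side (b : Bool) (F : Set (Item L)) (g : Param L → L.Term ℕ) : Set (Fml L) :=
  {A | ∃ i ∈ F, i.pol = b ∧ i.inst g = A}

theorem side_mono {b : Bool} {F F' : Set (Item L)} (h : F ⊆ F') (g : Param L → L.Term ℕ) :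
    side b F g ⊆ side b F' g := by
  rintro _ ⟨i, hi, hb, rfl⟩
  exact ⟨i, h hi, hb, rfl⟩

theorem mem_side {i : Item L} {F : Set (Item L)} (h : i ∈ F) (g : Param L → L.Term ℕ) :
    i.inst g ∈ side i.pol F g :=
  ⟨i, h, rfl, rfl⟩

/-- Cut-free provability of the sequent of a set of items. -/
def Prov (T : Set (OneWayClause L)) (F : Set (Item L)) (g : Param L → L.Term ℕ) : Prop :=
  PS (rewriteSystem T) False (side false F g) (side true F g)

/-- No finite part of `H` has a cut-free proof under all values of the parameters. -/
def Consistent (T : Set (OneWayClause L)) (H : Set (Item L)) : Prop :=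
  ∀ F : Set (Item L), F.Finite → F ⊆ H → ∃ g, ¬ Prov T F g

section Items

variable {T : Set (OneWayClause L)}

theorem Prov.mono {F F' : Set (Item L)} {g : Param L → L.Term ℕ} (h : Prov T F g) (hF : F ⊆ F') :
    Prov T F' g :=
  PS.mono h (side_mono hF g) (side_mono hF g)

theorem Prov.insert_left {A : Fml L} {σ : ℕ → L.Term (Param L)} {F : Set (Item L)}
    {g : Param L → L.Term ℕ} (h : Prov T (insert ⟨false, A, σ⟩ F) g) :
    PS (rewriteSystem T) False (insert (A.subst fun n => (σ n).subst g) (side false F g))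
      (side true F g) := by
  refine PS.mono h ?_ ?_
  · rintro _ ⟨i, rfl | hi, hb, rfl⟩
    · exact .inl rfl
    · exact .inr ⟨i, hi, hb, rfl⟩
  · rintro _ ⟨i, rfl | hi, hb, rfl⟩
    · cases hb
    · exact ⟨i, hi, hb, rfl⟩

theorem Prov.insert_right {A : Fml L} {σ : ℕ → L.Term (Param L)} {F : Set (Item L)}
    {g : Param L → L.Term ℕ} (h : Prov T (insert ⟨true, A, σ⟩ F) g) :
    PS (rewriteSystem T) False (side false F g)
      (insert (A.subst fun n => (σ n).subst g) (side true F g)) := by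
  refine PS.mono h ?_ ?_
  · rintro _ ⟨i, rfl | hi, hb, rfl⟩
    · cases hb
    · exact ⟨i, hi, hb, rfl⟩
  · rintro _ ⟨i, rfl | hi, hb, rfl⟩
    · exact .inl rfl
    · exact .inr ⟨i, hi, hb, rfl⟩

/-- `H` is maximal among the consistent sets of items of level at most `n`. -/
structure MaxConsistent (T : Set (OneWayClause L)) (n : ℕ) (H : Set (Item L)) : Prop where
  consistent : Consistent T H
  level : ∀ i ∈ H, EnvLevel n i.env
  mem : ∀ i : Item L, EnvLevel n i.env → Consistent T (insert i H) → i ∈ H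

/-- Consistency concerns finite parts only, so it passes to unions of chains and Zorn's lemma
applies, whatever the cardinality of the language. -/
theorem Consistent.exists_maxConsistent {n : ℕ} {H : Set (Item L)} (hH : Consistent T H)
    (hlevel : ∀ i ∈ H, EnvLevel n i.env) : ∃ H', H ⊆ H' ∧ MaxConsistent T n H' := by
  have hchain : ∀ c ⊆ {H : Set (Item L) | Consistent T H ∧ ∀ i ∈ H, EnvLevel n i.env},
      IsChain (· ⊆ ·) c → c.Nonempty →
      ∃ ub ∈ {H : Set (Item L) | Consistent T H ∧ ∀ i ∈ H, EnvLevel n i.env}, ∀ s ∈ c, s ⊆ ub := by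
    refine fun c hc hchain hne =>
      ⟨⋃₀ c, ⟨fun F hF hFc => ?_, ?_⟩, fun s hs => Set.subset_sUnion_of_mem hs⟩
    · obtain ⟨s, hs, hFs⟩ :=
        DirectedOn.exists_mem_subset_of_finite_of_subset_sUnion hne hchain.directedOn hF hFc
      exact (hc hs).1 F hF hFs
    · rintro i ⟨s, hs, hi⟩
      exact (hc hs).2 i hi
  obtain ⟨H', hsub, hmax⟩ := zorn_subset_nonempty _ hchain H ⟨hH, hlevel⟩
  refine ⟨H', hsub, hmax.prop.1, hmax.prop.2, fun i hi hcon => ?_⟩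
  refine hmax.le_of_ge ⟨hcon, ?_⟩ (Set.subset_insert i H') (Set.mem_insert i H')
  rintro j (rfl | hj)
  · exact hi
  · exact hmax.prop.2 j hj

/-- If a sequent that contains `F₀` can be proved from the premises obtained by adding one of the
items `js`, then a maximal consistent set that contains `F₀` contains one of them. -/
theorem MaxConsistent.exists_mem {n : ℕ} {H F₀ : Set (Item L)} (hH : MaxConsistent T n H)
    (hF₀ : F₀.Finite) (hF₀H : F₀ ⊆ H) {js : Set (Item L)} (hjs : js.Finite)
    (hlevel : ∀ j ∈ js, EnvLevel n j.env)
    (h : ∀ F, F₀ ⊆ F → ∀ g, (∀ j ∈ js, Prov T (insert j F) g) → Prov T F g) : ∃ j ∈ js, j ∈ H := by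
  by_contra! hcon
  have key : ∀ j ∈ js, ∃ F : Set (Item L), F.Finite ∧ F ⊆ H ∧ ∀ g, Prov T (insert j F) g := by
    intro j hj
    have hnot : ¬ Consistent T (insert j H) := fun hc => hcon j hj (hH.mem j (hlevel j hj) hc)
    unfold Consistent at hnot
    push Not at hnot
    obtain ⟨F, hF, hFH, hprov⟩ := hnot
    refine ⟨F \ {j}, hF.sdiff, fun i hi => (hFH hi.1).resolve_left hi.2, fun g => ?_⟩
    refine (hprov g).mono fun i hi => ?_
    by_cases hij : i = j
    · exact .inl hij
    · exact .inr ⟨hi, hij⟩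
  choose! F hF hFH hprov using key
  -- Each extended set is provable under all values of the parameters, so the single `g` that makes
  -- the union unprovable serves for all `j` at once.
  obtain ⟨g, hg⟩ := hH.consistent (F₀ ∪ ⋃ j ∈ js, F j) (hF₀.union (hjs.biUnion hF))
    (Set.union_subset hF₀H (Set.iUnion₂_subset hFH))
  refine hg (h _ Set.subset_union_left g fun j hj => (hprov j hj g).mono ?_)
  exact Set.insert_subset_insert
    ((Set.subset_biUnion_of_mem (u := F) hj).trans Set.subset_union_right)

/-- The literals of a set of items: `b` is the sign of the literal. -/
def HasLit (H : Set (Item L)) (b : Bool) (a : GroundAtom L (Param L)) : Prop :=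
  ∃ (P : Atom L) (σ : ℕ → L.Term (Param L)), ⟨!b, .atom P, σ⟩ ∈ H ∧ P.ground σ = a

/-- The item that gives a witness to `⊢ ∀ A`. -/
def witItem (n : ℕ) (A : Fml L) (σ : ℕ → L.Term (Param L)) : Item L :=
  ⟨true, A, scons (.var (.wit n A σ)) σ⟩

/-- Saturated sets of items. -/
structure Saturated (T : Set (OneWayClause L)) (H : Set (Item L)) : Prop where
  bot : ∀ σ, ⟨false, .bot, σ⟩ ∉ H
  neg : ∀ p A σ, ⟨p, .neg A, σ⟩ ∈ H → ⟨!p, A, σ⟩ ∈ H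
  orLeft : ∀ A B σ, ⟨false, .or A B, σ⟩ ∈ H → ⟨false, A, σ⟩ ∈ H ∨ ⟨false, B, σ⟩ ∈ H
  orRight : ∀ A B σ, ⟨true, .or A B, σ⟩ ∈ H → ⟨true, A, σ⟩ ∈ H ∧ ⟨true, B, σ⟩ ∈ H
  allLeft : ∀ A σ t, ⟨false, .all A, σ⟩ ∈ H → ⟨false, A, scons t σ⟩ ∈ H
  allRight : ∀ A σ, ⟨true, .all A, σ⟩ ∈ H → ∃ t, ⟨true, A, scons t σ⟩ ∈ H
  consistent : ∀ a, HasLit H true a → ¬ HasLit H false a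
  oneWay : ∀ c ∈ T, ∀ τ : ℕ → L.Term (Param L),
    HasLit H (!c.selected.pos) (c.selected.atom.ground τ) →
      ∃ l ∈ c.rest, HasLit H l.pos (l.atom.ground τ)


end Items

/-! ### Closure properties of a maximal consistent set -/

section Stages

variable {T : Set (OneWayClause L)} {n : ℕ} {H : Set (Item L)}

namespace MaxConsistent

/-- The case of one principal item and one item to add. -/
theorem mem_of_mem (hH : MaxConsistent T n H) {i j : Item L} (hi : i ∈ H) (hj : EnvLevel n j.env)
    (h : ∀ F, i ∈ F → ∀ g, Prov T (insert j F) g → Prov T F g) : j ∈ H := by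
  obtain ⟨_, rfl, hmem⟩ := hH.exists_mem (F₀ := {i}) (js := {j}) (Set.finite_singleton i)
    (Set.singleton_subset_iff.2 hi) (Set.finite_singleton j) (by simpa using hj)
    fun F hF g hprov => h F (hF rfl) g (hprov j rfl)
  exact hmem

theorem bot_notMem (hH : MaxConsistent T n H) (σ : ℕ → L.Term (Param L)) :
    ⟨false, .bot, σ⟩ ∉ H := by
  intro hi
  obtain ⟨_, h, _⟩ := hH.exists_mem (F₀ := {⟨false, .bot, σ⟩}) (js := ∅) (Set.finite_singleton _)
    (Set.singleton_subset_iff.2 hi) Set.finite_empty (by simp)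
    fun F hF g _ => PS.botLeft (mem_side (hF rfl) g)
  exact h

theorem neg_mem (hH : MaxConsistent T n H) {p : Bool} {A : Fml L} {σ : ℕ → L.Term (Param L)}
    (hi : ⟨p, .neg A, σ⟩ ∈ H) : ⟨!p, A, σ⟩ ∈ H := by
  refine hH.mem_of_mem hi (hH.level ⟨p, .neg A, σ⟩ hi :) fun F hF g h => ?_
  cases p with
  | false => exact PS.negLeft (mem_side hF g) h.insert_right
  | true => exact PS.negRight (mem_side hF g) h.insert_left

theorem or_left_mem (hH : MaxConsistent T n H) {A B : Fml L} {σ : ℕ → L.Term (Param L)}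
    (hi : ⟨false, .or A B, σ⟩ ∈ H) : ⟨false, A, σ⟩ ∈ H ∨ ⟨false, B, σ⟩ ∈ H := by
  obtain ⟨_, rfl | rfl, hj⟩ := hH.exists_mem (F₀ := {⟨false, .or A B, σ⟩})
    (js := {⟨false, A, σ⟩, ⟨false, B, σ⟩}) (Set.finite_singleton _)
    (Set.singleton_subset_iff.2 hi) ((Set.finite_singleton _).insert _)
    (by rintro _ (rfl | rfl) <;> exact (hH.level ⟨false, .or A B, σ⟩ hi :))
    fun F hF g h => PS.orLeft (mem_side (hF rfl) g) (h _ (.inl rfl)).insert_left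
      (h _ (.inr rfl)).insert_left
  · exact .inl hj
  · exact .inr hj

theorem or_right_mem (hH : MaxConsistent T n H) {A B : Fml L} {σ : ℕ → L.Term (Param L)}
    (hi : ⟨true, .or A B, σ⟩ ∈ H) : ⟨true, A, σ⟩ ∈ H ∧ ⟨true, B, σ⟩ ∈ H := by
  constructor
  · refine hH.mem_of_mem hi (hH.level ⟨true, .or A B, σ⟩ hi :) fun F hF g h => ?_
    exact PS.orRight (mem_side hF g) (h.insert_right.mono subset_rfl
      (Set.insert_subset_insert (Set.subset_insert _ _)))
  · refine hH.mem_of_mem hi (hH.level ⟨true, .or A B, σ⟩ hi :) fun F hF g h => ?_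
    exact PS.orRight (mem_side hF g) (h.insert_right.mono subset_rfl (Set.subset_insert _ _))

theorem scons_subst {α β : Type*} (t : L.Term α) (σ : ℕ → L.Term α) (g : α → L.Term β) :
    (fun n => (scons t σ n).subst g) = scons (t.subst g) fun n => (σ n).subst g := by
  funext n
  cases n <;> rfl

theorem all_left_mem (hH : MaxConsistent T n H) {A : Fml L} {σ : ℕ → L.Term (Param L)}
    {t : L.Term (Param L)} (hi : ⟨false, .all A, σ⟩ ∈ H)
    (ht : TermAll (fun w => w.level ≤ n) t) : ⟨false, A, scons t σ⟩ ∈ H := by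
  refine hH.mem_of_mem hi (EnvLevel.scons (hH.level _ hi) ht) fun F hF g h => ?_
  refine PS.allLeft (t.subst g) (mem_side hF g) ?_
  rw [Fml.inst_subst_up, ← scons_subst]
  exact h.insert_left

/-- Different atom–environment pairs may denote the same ground atom; they then coincide under every
`g`, and the axiom rule applies. -/
theorem not_conflict (hH : MaxConsistent T n H) {P Q : Atom L} {σ τ : ℕ → L.Term (Param L)}
    (hP : ⟨false, .atom P, σ⟩ ∈ H) (hQ : ⟨true, .atom Q, τ⟩ ∈ H) : P.ground σ ≠ Q.ground τ := by
  intro heq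
  obtain ⟨_, h, _⟩ := hH.exists_mem (F₀ := {⟨false, .atom P, σ⟩, ⟨true, .atom Q, τ⟩}) (js := ∅)
    ((Set.finite_singleton _).insert _)
    (Set.insert_subset hP (Set.singleton_subset_iff.2 hQ)) Set.finite_empty (by simp)
    fun F hF g _ => by
      refine PS.ax (P := (P.ground σ).toAtom g) ?_ ?_
      · rw [P.toAtom_ground]
        exact mem_side (hF (.inl rfl)) g
      · rw [heq, Q.toAtom_ground]
        exact mem_side (hF (.inr rfl)) g
  exact h

/-- `PS.oneWay` read from conclusion to premises. The bound on `τ` is needed because the new items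
have `τ` as their environment. -/
theorem oneWay_mem (hH : MaxConsistent T n H) {c : OneWayClause L} (hc : c ∈ T) {P : Atom L}
    {σ τ : ℕ → L.Term (Param L)} (hP : ⟨c.selected.pos, .atom P, σ⟩ ∈ H) (hτ : EnvLevel n τ)
    (heq : P.ground σ = c.selected.atom.ground τ) :
    ∃ l ∈ c.rest, ⟨!l.pos, .atom l.atom, τ⟩ ∈ H := by
  obtain ⟨_, ⟨l, hl, rfl⟩, hj⟩ := hH.exists_mem (F₀ := {⟨c.selected.pos, .atom P, σ⟩})
    (js := (fun l : Literal L => (⟨!l.pos, .atom l.atom, τ⟩ : Item L)) '' {l | l ∈ c.rest})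
    (Set.finite_singleton _) (Set.singleton_subset_iff.2 hP) ((List.finite_toSet _).image _)
    (by rintro _ ⟨l, -, rfl⟩; exact hτ) fun F hF g h => by
      have hsel : Fml.atom (c.selected.atom.subst fun n => (τ n).subst g) ∈
          side c.selected.pos F g := by
        rw [← Atom.toAtom_ground, ← heq, Atom.toAtom_ground]
        exact mem_side (hF rfl) g
      refine PS.oneWay hc (fun n => (τ n).subst g) (fun hp => hp ▸ hsel) (fun hp => hp ▸ hsel)
        fun l hl => ?_
      have := h _ ⟨l, hl, rfl⟩
      obtain ⟨_ | _, Q⟩ := l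
      · exact this.insert_right
      · exact this.insert_left
  exact ⟨l, hl, hj⟩

end MaxConsistent

/-! ### Adding witnesses -/

/-- The values of the parameters, shifted to make room for a new value of `w`. -/
noncomputable def shiftUpdate (g : Param L → L.Term ℕ) (w : Param L) : Param L → L.Term ℕ :=
  letI := Classical.decEq (Param L)
  Function.update (fun w => (g w).relabel Nat.succ) w (.var 0)

theorem subst_shiftUpdate {g : Param L → L.Term ℕ} {w : Param L} {t : L.Term (Param L)}
    (ht : TermAll (· ≠ w) t) :
    t.subst (shiftUpdate g w) = (t.subst g).relabel Nat.succ := by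
  rw [term_relabel_eq_subst, term_subst_subst]
  refine ht.subst_congr fun a ha => ?_
  simp [shiftUpdate, ha, term_relabel_eq_subst]

theorem subst_shiftUpdate_scons {g : Param L → L.Term ℕ} {w : Param L}
    {σ : ℕ → L.Term (Param L)} (hσ : ∀ n, TermAll (· ≠ w) (σ n)) :
    (fun n => (scons (.var w) σ n).subst (shiftUpdate g w)) =
      Subst.up fun n => (σ n).subst g := by
  funext n
  cases n with
  | zero => simp [scons, Term.subst, shiftUpdate, Subst.up]
  | succ n => exact subst_shiftUpdate (hσ n)

theorem Item.inst_shiftUpdate {g : Param L → L.Term ℕ} {w : Param L} {i : Item L}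
    (hi : ∀ n, TermAll (· ≠ w) (i.env n)) : i.inst (shiftUpdate g w) = (i.inst g).shift := by
  rw [Item.inst, Item.inst, Fml.shift, Fml.subst_subst]
  congr 1
  funext n
  rw [subst_shiftUpdate (hi n), term_relabel_eq_subst]
  rfl

theorem TermAll.ne_of_level {t : L.Term (Param L)} (ht : TermAll (fun w => w.level ≤ n) t)
    (A : Fml L) (σ : ℕ → L.Term (Param L)) : TermAll (· ≠ .wit n A σ) t :=
  ht.mono fun w hw h => by
    rw [h] at hw
    exact Nat.not_succ_le_self n hw

/-- Witnesses are added one by one, each as the eigenvariable of a ∀-right rule: a proof using the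
witness would be a premise of that rule. The witness is fresh for `H` by its level, and for the
other witnesses because it records `A` and `σ`. -/
theorem MaxConsistent.exists_not_prov_wit (hH : MaxConsistent T n H)
    (K : Set (Fml L × (ℕ → L.Term (Param L)))) (hK : K.Finite)
    (hKH : ∀ k ∈ K, ⟨true, .all k.1, k.2⟩ ∈ H) (F : Set (Item L)) (hF : F.Finite) (hFH : F ⊆ H) :
    ∃ g, ¬ Prov T (F ∪ (fun k => witItem n k.1 k.2) '' K) g := by
  induction K, hK using Set.Finite.induction_on generalizing F with
  | empty => simpa using hH.consistent F hF hFH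
  | @insert k K hk hK ih =>
    obtain ⟨A, σ⟩ := k
    have hall := hKH _ (.inl rfl)
    obtain ⟨g, hg⟩ := ih (fun k hk => hKH k (.inr hk)) (insert ⟨true, .all A, σ⟩ F)
      (hF.insert _) (Set.insert_subset hall hFH)
    -- The new parameter becomes the bound variable `0`; all other values are shifted past it.
    refine ⟨shiftUpdate g (.wit n A σ), fun hprov => hg ?_⟩
    have hshift : ∀ i ∈ F ∪ (fun k => witItem n k.1 k.2) '' K,
        i.inst (shiftUpdate g (.wit n A σ)) = (i.inst g).shift := by
      rintro i (hi | ⟨⟨B, τ⟩, hi, rfl⟩)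
      · exact Item.inst_shiftUpdate fun m => (hH.level i (hFH hi) m).ne_of_level A σ
      · refine Item.inst_shiftUpdate fun m => ?_
        cases m with
        | zero =>
          intro h
          obtain ⟨-, rfl, rfl⟩ := Param.wit.inj h
          exact hk hi
        | succ m => exact (hH.level _ (hKH _ (.inr hi)) m).ne_of_level A σ
    have hwit : (witItem n A σ).inst (shiftUpdate g (.wit n A σ)) =
        A.subst (Subst.up fun n => (σ n).subst g) :=
      congrArg A.subst (subst_shiftUpdate_scons fun m => (hH.level _ hall m).ne_of_level A σ)
    have hsub : F ∪ (fun k => witItem n k.1 k.2) '' K ⊆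
        insert ⟨true, .all A, σ⟩ F ∪ (fun k => witItem n k.1 k.2) '' K :=
      Set.union_subset_union_left _ (Set.subset_insert _ _)
    refine PS.allRight (mem_side (Set.mem_union_left _ (Set.mem_insert _ _)) g) (PS.mono hprov ?_ ?_)
    · rintro _ ⟨i, hi | ⟨k, rfl | hk, rfl⟩, hp, rfl⟩
      · exact ⟨_, ⟨i, hsub (.inl hi), hp, rfl⟩, (hshift i (.inl hi)).symm⟩
      · cases hp
      · have hi : witItem n k.1 k.2 ∈ F ∪ (fun k => witItem n k.1 k.2) '' K := .inr ⟨k, hk, rfl⟩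
        exact ⟨_, ⟨_, hsub hi, hp, rfl⟩, (hshift _ hi).symm⟩
    · rintro _ ⟨i, hi | ⟨k, rfl | hk, rfl⟩, hp, rfl⟩
      · exact .inr ⟨_, ⟨i, hsub (.inl hi), hp, rfl⟩, (hshift i (.inl hi)).symm⟩
      · exact .inl hwit
      · have hi : witItem n k.1 k.2 ∈ F ∪ (fun k => witItem n k.1 k.2) '' K := .inr ⟨k, hk, rfl⟩
        exact .inr ⟨_, ⟨_, hsub hi, hp, rfl⟩, (hshift _ hi).symm⟩

/-- The next stage: all the universally quantified propositions on the right get a witness. -/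
theorem MaxConsistent.exists_succ (hH : MaxConsistent T n H) :
    ∃ H', MaxConsistent T (n + 1) H' ∧ H ⊆ H' ∧
      ∀ A σ, ⟨true, .all A, σ⟩ ∈ H → witItem n A σ ∈ H' := by
  let W : Set (Fml L × (ℕ → L.Term (Param L))) := {k | ⟨true, .all k.1, k.2⟩ ∈ H}
  have hcon : Consistent T (H ∪ (fun k => witItem n k.1 k.2) '' W) := by
    intro F hF hFH
    -- Injectivity ensures that the finite set `F` involves only finitely many witnessed
    -- propositions.
    have hinj : Function.Injective fun k : Fml L × (ℕ → L.Term (Param L)) =>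
        witItem n k.1 k.2 := by
      intro k k' h
      have h₀ := Term.var.inj (congrFun (congrArg Item.env h) 0)
      obtain ⟨-, h₁, h₂⟩ := Param.wit.inj h₀
      exact Prod.ext h₁ h₂
    obtain ⟨g, hg⟩ := hH.exists_not_prov_wit
      (W ∩ (fun k => witItem n k.1 k.2) ⁻¹' F) ((hF.preimage hinj.injOn).inter_of_right _)
      (fun k hk => hk.1) (F ∩ H) (hF.inter_of_left _) Set.inter_subset_right
    refine ⟨g, fun hprov => hg (hprov.mono fun i hi => ?_)⟩
    rcases hFH hi with h | ⟨k, hk, rfl⟩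
    · exact .inl ⟨hi, h⟩
    · exact .inr ⟨k, ⟨hk, hi⟩, rfl⟩
  obtain ⟨H', hsub, hH'⟩ := hcon.exists_maxConsistent (n := n + 1) (by
    rintro i (hi | ⟨k, hk, rfl⟩)
    · exact EnvLevel.mono (hH.level i hi) (Nat.le_succ n)
    · exact EnvLevel.scons (EnvLevel.mono (hH.level _ hk) (Nat.le_succ n))
        (show Param.level _ ≤ n + 1 from le_rfl))
  exact ⟨H', hH', Set.subset_union_left.trans hsub, fun A σ h => hsub (.inr ⟨(A, σ), h, rfl⟩)⟩


end Stages

variable {T : Set (OneWayClause L)}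

/-- A consistent set of items of level `0` can be saturated. -/
theorem Consistent.exists_saturated {H₀ : Set (Item L)} (hH₀ : Consistent T H₀)
    (hlevel : ∀ i ∈ H₀, EnvLevel 0 i.env) : ∃ H, H₀ ⊆ H ∧ Saturated T H := by
  obtain ⟨I, hI, hImax⟩ := hH₀.exists_maxConsistent hlevel
  let stage : ∀ n, {H : Set (Item L) // MaxConsistent T n H} := fun n =>
    Nat.rec ⟨I, hImax⟩ (fun _ H => ⟨H.2.exists_succ.choose, H.2.exists_succ.choose_spec.1⟩) n
  have hmax : ∀ n, MaxConsistent T n (stage n).1 := fun n => (stage n).2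
  have hsucc : ∀ n, (stage n).1 ⊆ (stage (n + 1)).1 := fun n =>
    (stage n).2.exists_succ.choose_spec.2.1
  have hwit : ∀ n A σ, ⟨true, .all A, σ⟩ ∈ (stage n).1 → witItem n A σ ∈ (stage (n + 1)).1 :=
    fun n => (stage n).2.exists_succ.choose_spec.2.2
  have hmono : ∀ {m n : ℕ}, m ≤ n → ∀ {i : Item L}, i ∈ (stage m).1 → i ∈ (stage n).1 :=
    fun h _ hi => monotone_nat_of_le_succ (f := fun n => (stage n).1) hsucc h hi
  refine ⟨⋃ n, (stage n).1, hI.trans (Set.subset_iUnion (fun n => (stage n).1) 0), ?_⟩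
  constructor
  · intro σ hσ
    obtain ⟨n, hn⟩ := Set.mem_iUnion.1 hσ
    exact (hmax n).bot_notMem σ hn
  · intro p A σ h
    obtain ⟨n, hn⟩ := Set.mem_iUnion.1 h
    exact Set.mem_iUnion.2 ⟨n, (hmax n).neg_mem hn⟩
  · intro A B σ h
    obtain ⟨n, hn⟩ := Set.mem_iUnion.1 h
    exact ((hmax n).or_left_mem hn).imp (fun h => Set.mem_iUnion.2 ⟨n, h⟩)
      fun h => Set.mem_iUnion.2 ⟨n, h⟩
  · intro A B σ h
    obtain ⟨n, hn⟩ := Set.mem_iUnion.1 h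
    exact ((hmax n).or_right_mem hn).imp (fun h => Set.mem_iUnion.2 ⟨n, h⟩)
      fun h => Set.mem_iUnion.2 ⟨n, h⟩
  · intro A σ t h
    obtain ⟨n, hn⟩ := Set.mem_iUnion.1 h
    obtain ⟨m, hm⟩ := exists_termAll_level t
    exact Set.mem_iUnion.2 ⟨max n m, (hmax _).all_left_mem (hmono (le_max_left n m) hn)
      (hm.mono fun w hw => hw.trans (le_max_right n m))⟩
  · intro A σ h
    obtain ⟨n, hn⟩ := Set.mem_iUnion.1 h
    exact ⟨_, Set.mem_iUnion.2 ⟨n + 1, hwit n A σ hn⟩⟩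
  · rintro a ⟨P, σ, hP, rfl⟩ ⟨Q, τ, hQ, heq⟩
    obtain ⟨n, hn⟩ := Set.mem_iUnion.1 hP
    obtain ⟨m, hm⟩ := Set.mem_iUnion.1 hQ
    exact (hmax (max n m)).not_conflict (hmono (le_max_left n m) hn)
      (hmono (le_max_right n m) hm) heq.symm
  · rintro c hc τ ⟨P, σ, hP, heq⟩
    classical
    obtain ⟨n, hn⟩ := Set.mem_iUnion.1 hP
    rw [Bool.not_not] at hn
    obtain ⟨V, hV⟩ := exists_finset_vars c.toClause
    choose k hk using fun x => exists_termAll_level (τ x)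
    -- `τ` may have parameters of unbounded level, but only its values on the variables of `c`
    -- matter; elsewhere a parameter of level `0` keeps `τ'` within one stage.
    let τ' : ℕ → L.Term (Param L) := fun x => if x ∈ V then τ x else .var (.base 0)
    have hτ' : EnvLevel (max n (V.sup k)) τ' := by
      intro x
      simp only [τ']
      split_ifs with hx
      · exact (hk x).mono fun w hw =>
          hw.trans ((Finset.le_sup hx).trans (le_max_right _ _))
      · exact Nat.zero_le _
    have hground : ∀ l ∈ c.toClause, l.atom.ground τ' = l.atom.ground τ := fun l hl =>
      Atom.ground_congr fun x hx => if_pos (hV l hl hx)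
    obtain ⟨l, hl, hmem⟩ := (hmax _).oneWay_mem hc (hmono (le_max_left n (V.sup k)) hn) hτ'
      (heq.trans (hground _ (Multiset.mem_cons_self _ _)).symm)
    exact ⟨l, hl, l.atom, τ', Set.mem_iUnion.2 ⟨_, hmem⟩,
      hground l (Multiset.mem_cons_of_mem hl)⟩

/-! ### The term model of a saturated set -/

/-- `v` is any extension of the literals of `H`; the atoms that `H` leaves undecided are free and
will be used to satisfy `T`. -/
theorem Saturated.realize {H : Set (Item L)} (hH : Saturated T H)
    (v : GroundAtom L (Param L) → Bool) (hv : ∀ b a, HasLit H b a → v a = b) (A : Fml L)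
    (σ : ℕ → L.Term (Param L)) :
    letI := termStructure (L := L) (α := Param L) fun n r ts => v ⟨n, r, ts⟩ = true
    (⟨false, A, σ⟩ ∈ H → A.Realize σ) ∧ (⟨true, A, σ⟩ ∈ H → ¬ A.Realize σ) := by
  let := termStructure (L := L) (α := Param L) fun n r ts => v ⟨n, r, ts⟩ = true
  induction A generalizing σ with
  | bot => exact ⟨fun h => (hH.bot σ h).elim, fun _ h => h⟩
  | atom P =>
    have hP : (Fml.atom P).Realize σ ↔ v (P.ground σ) = true := by
      simp only [Fml.Realize, termStructure_realize]
      rfl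
    rw [hP]
    refine ⟨fun h => hv true _ ⟨P, σ, h, rfl⟩, fun h => ?_⟩
    rw [hv false _ ⟨P, σ, h, rfl⟩]
    exact Bool.false_ne_true
  | neg A ih =>
    exact ⟨fun h => (ih σ).2 (hH.neg _ _ _ h), fun h h' => h' ((ih σ).1 (hH.neg _ _ _ h))⟩
  | or A B ihA ihB =>
    refine ⟨fun h => (hH.orLeft _ _ _ h).imp (ihA σ).1 (ihB σ).1, fun h h' => ?_⟩
    obtain ⟨hA, hB⟩ := hH.orRight _ _ _ h
    exact h'.elim ((ihA σ).2 hA) ((ihB σ).2 hB)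
  | all A ih =>
    refine ⟨fun h t => (ih _).1 (hH.allLeft _ _ t h), fun h h' => ?_⟩
    obtain ⟨t, ht⟩ := hH.allRight _ _ h
    exact (ih _).2 ht (h' t)

/-- The items of a sequent. -/
def sequentItems (Γ Δ : Multiset (Fml L)) : Set (Item L) :=
  {i | i.env = (fun k => .var (.base k)) ∧
    (i.pol = false ∧ i.fml ∈ Γ ∨ i.pol = true ∧ i.fml ∈ Δ)}

/-- Such a `v` would make the terms over parameters a model of `T` that refutes the provable
sequent. This model may lie in a larger universe than those of `Unsatisfiable`, but soundness holds
in every universe. -/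
theorem Saturated.not_exists_valuation {H : Set (Item L)} (hH : Saturated T H)
    {Γ Δ : Multiset (Fml L)} (hsub : sequentItems Γ Δ ⊆ H) {c : Prop}
    (hseq : Sequent (rewriteSystem T) c Γ Δ) :
    ¬ ∃ v : GroundAtom L (Param L) → Bool,
      (∀ w ∈ T, ∀ τ : ℕ → L.Term (Param L), ∃ l ∈ w.toClause, v (l.atom.ground τ) = l.pos) ∧
      ∀ b a, HasLit H b a → v a = b := by
  rintro ⟨v, hvT, hv⟩
  let := termStructure (L := L) (α := Param L) fun n r ts => v ⟨n, r, ts⟩ = true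
  have hT : ∀ w ∈ T, ∀ s : ℕ → L.Term (Param L), w.ValidAt s := by
    intro w hw s
    have hlit : ∀ l : Literal L, v (l.atom.ground s) = l.pos → l.toFml.Realize s := by
      intro l hl
      have hP : (Fml.atom l.atom).Realize s ↔ v (l.atom.ground s) = true := by
        simp only [Fml.Realize, termStructure_realize]
        rfl
      unfold Literal.toFml
      split_ifs with hp
      · exact hP.2 (hl.trans hp)
      · exact fun h => hp (hl.symm.trans (hP.1 h))
    obtain ⟨l, hl, h⟩ := hvT w hw s
    rcases Multiset.mem_cons.1 hl with rfl | hl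
    · exact .inl (hlit _ h)
    · exact .inr ⟨l, hl, hlit l h⟩
  obtain ⟨A, hA, hreal⟩ := hseq.realize hT (fun k => .var (.base k)) fun A hA =>
    (hH.realize v hv A _).1 (hsub ⟨rfl, .inl ⟨rfl, hA⟩⟩)
  exact (hH.realize v hv A _).2 (hsub ⟨rfl, .inr ⟨rfl, hA⟩⟩) hreal

/-! ### An unprovable sequent as a consistent set of items -/

theorem Sequent.contract_subset {R : Set (Rule L)} {c : Prop} {Γ Γ' Δ Δ' : Multiset (Fml L)}
    (h : Sequent R c Γ' Δ') (hΓ : ∀ A ∈ Γ', A ∈ Γ) (hΔ : ∀ A ∈ Δ', A ∈ Δ) : Sequent R c Γ Δ := by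
  have h₁ : Sequent R c Γ Δ' := by
    replace h : Sequent R c (Γ' + Γ) Δ' := by simpa [add_comm] using h.weaken Γ 0
    induction Γ' using Multiset.induction with
    | empty => simpa using h
    | cons A Γ' ih =>
      obtain ⟨hA, hΓ'⟩ := Multiset.forall_mem_cons.1 hΓ
      refine ih hΓ' ?_
      obtain ⟨G, rfl⟩ := Multiset.exists_cons_of_mem hA
      rw [Multiset.cons_add, Multiset.add_cons] at h
      rw [Multiset.add_cons]
      exact h.contrLeft _ _ _ _ _ .refl .refl
  replace h₁ : Sequent R c Γ (Δ' + Δ) := by simpa [add_comm] using h₁.weaken 0 Δ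
  clear h
  induction Δ' using Multiset.induction with
  | empty => simpa using h₁
  | cons A Δ' ih =>
    obtain ⟨hA, hΔ'⟩ := Multiset.forall_mem_cons.1 hΔ
    refine ih hΔ' ?_
    obtain ⟨D, rfl⟩ := Multiset.exists_cons_of_mem hA
    rw [Multiset.cons_add, Multiset.add_cons] at h₁
    rw [Multiset.add_cons]
    exact h₁.contrRight _ _ _ _ _ .refl .refl

theorem consistent_sequentItems {Γ Δ : Multiset (Fml L)}
    (h : ¬ Sequent (rewriteSystem T) False Γ Δ) : Consistent T (sequentItems Γ Δ) := by
  intro F _ hF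
  -- Base parameters turn back into the free variables they name; no witness occurs in these items,
  -- so their value is arbitrary.
  let g : Param L → L.Term ℕ
    | .base k => .var k
    | .wit _ _ _ => .var 0
  have hinst : ∀ i ∈ F, i.inst g = i.fml := by
    intro i hi
    rw [Item.inst, (hF hi).1]
    exact i.fml.subst_var
  refine ⟨g, fun ⟨Γ', Δ', hΓ, hΔ, hseq⟩ => h (hseq.contract_subset (fun A hA => ?_) fun A hA => ?_)⟩
  · obtain ⟨i, hi, hp, rfl⟩ := hΓ A hA
    rw [hinst i hi]
    rcases (hF hi).2 with h | h
    · exact h.2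
    · rw [hp] at h
      cases h.1
  · obtain ⟨i, hi, hp, rfl⟩ := hΔ A hA
    rw [hinst i hi]
    rcases (hF hi).2 with h | h
    · rw [hp] at h
      cases h.1
    · exact h.2

/-- Finitely many literals of a saturated set contradict the one-way clauses. -/
theorem exists_finite_hasLit {H : Set (Item L)}
    (h : ¬ ∃ v : GroundAtom L (Param L) → Bool,
      (∀ w ∈ T, ∀ τ : ℕ → L.Term (Param L), ∃ l ∈ w.toClause, v (l.atom.ground τ) = l.pos) ∧
      ∀ b a, HasLit H b a → v a = b) :
    ∃ Q : Set (Bool × GroundAtom L (Param L)), Q.Finite ∧ (∀ q ∈ Q, HasLit H q.1 q.2) ∧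
      ¬ ∃ v : GroundAtom L (Param L) → Bool,
        (∀ w ∈ T, ∀ τ : ℕ → L.Term (Param L), ∃ l ∈ w.toClause, v (l.atom.ground τ) = l.pos) ∧
        ∀ q ∈ Q, v q.2 = q.1 := by
  classical
  obtain ⟨t, ht⟩ := exists_finset_unsat
    (ι := (T × (ℕ → L.Term (Param L))) ⊕
      {q : Bool × GroundAtom L (Param L) // HasLit H q.1 q.2})
    (Sum.elim (fun i => i.1.1.toClause.map fun l => (l.pos, l.atom.ground i.2))
      fun q => {q.1}) (by
      rintro ⟨v, hv⟩
      refine h ⟨v, fun w hw τ => ?_, fun b a hba => ?_⟩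
      · obtain ⟨_, hl, hvl⟩ := hv (.inl (⟨w, hw⟩, τ))
        rw [Sum.elim_inl] at hl
        obtain ⟨l, hl', rfl⟩ := Multiset.mem_map.1 hl
        exact ⟨l, hl', hvl⟩
      · obtain ⟨q, hq, hvq⟩ := hv (.inr ⟨(b, a), hba⟩)
        rw [Sum.elim_inr] at hq
        obtain rfl := Multiset.mem_singleton.1 hq
        exact hvq)
  refine ⟨Subtype.val '' {q | Sum.inr q ∈ t}, ?_, ?_, ?_⟩
  · exact (t.finite_toSet.preimage Sum.inr_injective.injOn).image _
  · rintro _ ⟨q, -, rfl⟩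
    exact q.2
  · rintro ⟨v, hvT, hvQ⟩
    refine ht ⟨v, ?_⟩
    rintro (⟨⟨w, hw⟩, τ⟩ | q) hi
    · obtain ⟨l, hl, h⟩ := hvT w hw τ
      exact ⟨_, Multiset.mem_map_of_mem _ hl, h⟩
    · exact ⟨q.1, Multiset.mem_singleton_self _, hvQ _ ⟨q, hi, rfl⟩⟩

/-! ### Replacing parameters by fresh constants -/

/-- The function symbol `x` occurs in a term. -/
def UsesSymbol {α : Type*} (x : Σ n, L.Functions n) : L.Term α → Prop
  | .var _ => False
  | .func g ts => x = ⟨_, g⟩ ∨ ∃ i, UsesSymbol x (ts i)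

theorem usesSymbol_iff_termUses {n : ℕ} (f : L.Functions n) (t : L.Term ℕ) :
    UsesSymbol ⟨n, f⟩ t ↔ TermUses f t := by
  induction t with
  | var x => rfl
  | func g ts ih => simp only [UsesSymbol, TermUses, ih]

theorem finite_usesSymbol {α : Type*} (t : L.Term α) : {x | UsesSymbol x t}.Finite := by
  induction t with
  | var a => exact Set.finite_empty
  | func f ts ih =>
    have : {x | UsesSymbol x (Term.func f ts)} ⊆ {⟨_, f⟩} ∪ ⋃ i, {x | UsesSymbol x (ts i)} := by
      rintro x (h | ⟨i, hi⟩)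
      · exact .inl h
      · exact .inr (Set.mem_iUnion.2 ⟨i, hi⟩)
    exact ((Set.finite_singleton _).union (Set.finite_iUnion ih)).subset this

/-- The term structure in which some symbols are interpreted by variables. -/
abbrev interpStructure {α : Type*} (K : (Σ n, L.Functions n) → Option α) :
    L.Structure (L.Term α) where
  funMap f ts := (K ⟨_, f⟩).elim (Term.func f ts) Term.var
  -- A dummy value: only the functions are used, and membership of literals in `H` plays the role of
  -- truth.
  RelMap _ _ := False

theorem interpStructure_realize_of_notUses {α : Type*} {K : (Σ n, L.Functions n) → Option α}
    {t : L.Term ℕ} (ht : ∀ x, UsesSymbol x t → K x = none) (s : ℕ → L.Term α) :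
    letI := interpStructure K
    t.realize s = t.subst s := by
  induction t with
  | var n => rfl
  | func f ts ih =>
    have h₁ := funext fun i => ih i fun x hx => ht x (.inr ⟨i, hx⟩)
    simp only [Term.realize, FirstOrder.Language.Structure.funMap, ht _ (.inl rfl),
      Option.elim_none, Term.subst, h₁]

/-- Naming parameters by constants and interpreting these constants as the parameters gives back the
original term. -/
theorem interpStructure_realize_subst {α : Type*} {K : (Σ n, L.Functions n) → Option α}
    {t : L.Term α} (ht : ∀ x, UsesSymbol x t → K x = none) {k : α → L.Functions 0}
    (hk : TermAll (fun a => K ⟨0, k a⟩ = some a) t) (s : ℕ → L.Term α) :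
    letI := interpStructure K
    (t.subst fun a => Term.func (k a) ![]).realize s = t := by
  induction t with
  | var a =>
    have h₁ : K ⟨0, k a⟩ = some a := hk
    simp only [Term.subst, Term.realize, FirstOrder.Language.Structure.funMap, h₁,
      Option.elim_some]
  | func f ts ih =>
    have h₁ := funext fun i => ih i (fun x hx => ht x (.inr ⟨i, hx⟩)) (hk i)
    simp only [Term.subst, Term.realize, FirstOrder.Language.Structure.funMap, ht _ (.inl rfl),
      Option.elim_none, h₁]

/-- Infinitely many symbols suffice to name finitely many elements. -/
theorem exists_naming {α β : Type*} {W : Set α} (hW : W.Finite) {S : Set β} (hS : S.Infinite) :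
    ∃ k : α → β, (∀ a, k a ∈ S) ∧ Set.InjOn k W := by
  obtain ⟨f, hf⟩ := Set.countable_iff_exists_injOn.1 hW.countable
  exact ⟨fun a => hS.natEmbedding _ (f a), fun a => Subtype.property _, fun a ha b hb h =>
    hf ha hb ((hS.natEmbedding _).injective (Subtype.ext h))⟩

/-- The value of an atom in a structure on terms. -/
def Atom.value {α : Type*} [L.Structure (L.Term α)] (P : Atom L) (s : ℕ → L.Term α) :
    GroundAtom L α :=
  ⟨P.arity, P.rel, fun i => (P.args i).realize s⟩

theorem Atom.value_subst {α : Type*} [L.Structure (L.Term α)] (P : Atom L) (σ : Subst L)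
    (s : ℕ → L.Term α) : (P.subst σ).value s = P.value fun n => (σ n).realize s := by
  simp [Atom.value, Atom.subst]

/-! ### Completeness implies cut admissibility -/

/-- Every derivable clause contains a literal of the saturated set, for all values of its
variables. -/
theorem Saturated.exists_hasLit {H : Set (Item L)} (hH : Saturated T H) {U : Set (Clause L)}
    [L.Structure (L.Term (Param L))]
    (hT : ∀ c ∈ T, ∀ l ∈ c.toClause, ∀ s : ℕ → L.Term (Param L),
      l.atom.value s = l.atom.ground s)
    (hU : ∀ C ∈ U, ∀ s : ℕ → L.Term (Param L), ∃ l ∈ C, HasLit H l.pos (l.atom.value s))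
    {C : Clause L} (h : Derives T U C) (s : ℕ → L.Term (Param L)) :
    ∃ l ∈ C, HasLit H l.pos (l.atom.value s) := by
  have hsubst : ∀ (C : Clause L) (σ : Subst L) (s : ℕ → L.Term (Param L)),
      (∃ l ∈ C, HasLit H l.pos (l.atom.value fun n => (σ n).realize s)) →
      ∃ l ∈ C.subst σ, HasLit H l.pos (l.atom.value s) := by
    rintro C σ s ⟨l, hl, h⟩
    exact ⟨_, Multiset.mem_map_of_mem _ hl, by rwa [Literal.subst, Atom.value_subst]⟩
  have hunif : ∀ {S : Set (Atom L)} {σ : Subst L}, IsMGU σ S → ∀ (s : ℕ → L.Term (Param L)),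
      ∀ P ∈ S, ∀ Q ∈ S, (P.value fun n => (σ n).realize s) = Q.value fun n => (σ n).realize s := by
    intro S σ hσ s P hP Q hQ
    rw [← Atom.value_subst, ← Atom.value_subst, hσ.1 P hP Q hQ]
  induction h generalizing s with
  | input C hC => exact hU C hC s
  | rename C ρ _ ih => exact hsubst _ _ _ (ih _)
  | resolve K C N D σ _ _ hK hN _ hσ _ _ ih₁ ih₂ =>
    refine hsubst _ _ _ ?_
    obtain ⟨l, hl, h₁⟩ := ih₁ fun n => (σ n).realize s
    obtain ⟨m, hm, h₂⟩ := ih₂ fun n => (σ n).realize s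
    rcases Multiset.mem_add.1 hl with hl | hl
    · rcases Multiset.mem_add.1 hm with hm | hm
      · rw [hK l hl] at h₁
        rw [hN m hm, hunif hσ s m.atom ⟨m, Multiset.mem_add.2 (.inr hm), rfl⟩ l.atom
          ⟨l, Multiset.mem_add.2 (.inl hl), rfl⟩] at h₂
        -- Both premises cannot have their `H`-literal among those resolved upon, for these are
        -- complementary with the same ground atom.
        exact (hH.consistent _ h₁ h₂).elim
      · exact ⟨m, Multiset.mem_add.2 (.inr hm), h₂⟩
    · exact ⟨l, Multiset.mem_add.2 (.inl hl), h₁⟩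
  | resolveOneWay c ρ K D σ hc _ hopp _ hσ _ ih =>
    refine hsubst _ _ _ ?_
    obtain ⟨l, hl, h⟩ := ih fun n => (σ n).realize s
    rcases Multiset.mem_add.1 hl with hl | hl
    · rw [hopp l hl, hunif hσ s l.atom (.inr ⟨l, hl, rfl⟩) _ (.inl rfl), OneWayClause.subst,
        Literal.subst, Atom.value_subst, hT c hc _ (Multiset.mem_cons_self _ _)] at h
      -- The `H`-literal contradicts the selected literal, so closure under `T` supplies one of the
      -- others under the same assignment.
      obtain ⟨m, hm, h⟩ := hH.oneWay c hc _ h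
      refine ⟨m.subst (renameSubst ρ), Multiset.mem_add.2 (.inl ?_), ?_⟩
      · exact Multiset.mem_coe.2 (List.mem_map_of_mem hm)
      · rwa [Literal.subst, Atom.value_subst, hT c hc _ (Multiset.mem_cons_of_mem hm)]
    · exact ⟨l, Multiset.mem_add.2 (.inr hl), h⟩

theorem admitsCut_of_resolutionComplete
    (hfresh : {f : L.Functions 0 | ¬ OccursIn f T}.Infinite) (h : ResolutionComplete T) :
    AdmitsCut (rewriteSystem T) := by
  classical
  intro Γ Δ hseq
  by_contra hcut
  obtain ⟨H, hsub, hH⟩ := (consistent_sequentItems hcut).exists_saturated (by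
    rintro i ⟨hi, -⟩ n
    rw [hi]
    exact le_rfl)
  obtain ⟨Q, hQ, hQH, hun⟩ := exists_finite_hasLit (hH.not_exists_valuation hsub hseq)
  choose W hW hWt using fun t : L.Term (Param L) => exists_finite_termAll t
  let params : Set (Param L) := ⋃ q ∈ Q, ⋃ i, W (q.2.args i)
  have hparams : params.Finite := hQ.biUnion fun q _ => Set.finite_iUnion fun i => hW _
  let symbols : Set (Σ n, L.Functions n) := ⋃ q ∈ Q, ⋃ i, {x | UsesSymbol x (q.2.args i)}
  have hsymbols : symbols.Finite :=
    hQ.biUnion fun q _ => Set.finite_iUnion fun i => finite_usesSymbol _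
  have hinj : Function.Injective (Sigma.mk 0 : L.Functions 0 → Σ n, L.Functions n) :=
    sigma_mk_injective
  -- The names must avoid both `T` and the symbols already in `Q`, so that reinterpreting them
  -- leaves both unchanged.
  obtain ⟨k, hk, hkinj⟩ := exists_naming hparams
    (hfresh.sdiff (hsymbols.preimage hinj.injOn))
  let K : (Σ n, L.Functions n) → Option (Param L) := fun x =>
    if hx : ∃ a ∈ params, x = ⟨0, k a⟩ then some hx.choose else none
  have hKparams : ∀ a ∈ params, K ⟨0, k a⟩ = some a := by
    intro a ha
    have hx : ∃ b ∈ params, (⟨0, k a⟩ : Σ n, L.Functions n) = ⟨0, k b⟩ := ⟨a, ha, rfl⟩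
    simp only [K, dif_pos hx]
    exact congrArg some (hkinj hx.choose_spec.1 ha (hinj hx.choose_spec.2).symm)
  have hKnone : ∀ x, (∀ a, x ≠ ⟨0, k a⟩) → K x = none := fun x hx =>
    dif_neg fun ⟨a, _, h⟩ => hx a h
  let e : Param L → L.Term ℕ := fun a => Term.func (k a) ![]
  let U : Set (Clause L) := (fun q => {⟨q.1, q.2.toAtom e⟩}) '' Q
  have hder : Derives T U 0 := by
    -- A model of `T` and the unit clauses induces a valuation of ground atoms, each parameter being
    -- evaluated as the constant that names it; `hun` forbids this.
    refine h U fun M _ _ hM => hun ?_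
    let s₀ : ℕ → M := fun _ => Classical.arbitrary M
    let r : L.Term (Param L) → M := fun t => t.realize fun a => (e a).realize s₀
    refine ⟨fun a => decide (FirstOrder.Language.Structure.RelMap a.rel fun i => r (a.args i)),
      fun w hw τ => ?_, fun q hq => ?_⟩
    · obtain ⟨l, hl, hholds⟩ := hM _ (.inl ⟨w, hw, rfl⟩) fun n => r (τ n)
      refine ⟨l, hl, ?_⟩
      have : l.atom.Holds (fun n => r (τ n)) ↔ FirstOrder.Language.Structure.RelMap
          (l.atom.ground τ).rel fun i => r ((l.atom.ground τ).args i) := by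
        simp only [Atom.Holds, Atom.ground, r, Term.realize_subst]
      rw [Literal.Holds, this] at hholds
      cases hp : l.pos <;> simpa [hp] using hholds
    · obtain ⟨l, hl, hholds⟩ := hM _ (.inr ⟨q, hq, rfl⟩) s₀
      obtain rfl := Multiset.mem_singleton.1 hl
      have : (q.2.toAtom e).Holds s₀ ↔ FirstOrder.Language.Structure.RelMap
          q.2.rel fun i => r (q.2.args i) := by
        simp only [Atom.Holds, GroundAtom.toAtom, r, Term.realize_subst]
      simp only [Literal.Holds, this] at hholds
      cases hp : q.1 <;> simpa [hp] using hholds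
  -- In this structure the fresh constants denote their parameters again, so the unit clauses
  -- evaluate to the literals of `Q`, which lie in `H`.
  let := interpStructure K
  suffices hlit : ∃ l ∈ (0 : Clause L), HasLit H l.pos (l.atom.value fun _ => .var (.base 0)) by
    obtain ⟨l, hl, -⟩ := hlit
    exact Multiset.notMem_zero l hl
  refine hH.exists_hasLit (U := U) (fun c hc l hl s => ?_) ?_ hder _
  · simp only [Atom.value, Atom.ground, GroundAtom.mk.injEq, heq_eq_eq, true_and]
    refine funext fun i => interpStructure_realize_of_notUses (fun x hx => hKnone x ?_) s
    rintro a rfl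
    exact (hk a).1 ⟨c, hc, l, hl, i, (usesSymbol_iff_termUses _ _).1 hx⟩
  · rintro _ ⟨q, hq, rfl⟩ s
    refine ⟨_, Multiset.mem_singleton_self _, ?_⟩
    have : (q.2.toAtom e).value s = q.2 := by
      obtain ⟨b, n, r, ts⟩ := q
      simp only [Atom.value, GroundAtom.toAtom, GroundAtom.mk.injEq, heq_eq_eq, true_and]
      refine funext fun i => interpStructure_realize_subst (fun x hx => hKnone x ?_)
        ((hWt (ts i)).mono fun a ha => hKparams a ?_) s
      · rintro a rfl
        exact (hk a).2 (Set.mem_biUnion hq (Set.mem_iUnion.2 ⟨i, hx⟩))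
      · exact Set.mem_biUnion hq (Set.mem_iUnion.2 ⟨i, ha⟩)
    rw [this]
    exact hQH q hq

end PolRes

theorem mainTheorem4 {L : FirstOrder.Language.{u, v}} (T : Set (PolRes.OneWayClause L))
    (hfresh : ∀ n : ℕ, {f : L.Functions n | ¬ PolRes.OccursIn f T}.Infinite) :
    PolRes.ResolutionComplete T ↔ PolRes.AdmitsCut (PolRes.rewriteSystem T) :=
  ⟨PolRes.admitsCut_of_resolutionComplete (hfresh 0), PolRes.resolutionComplete_of_admitsCut⟩
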